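/- Let $\nu\ge 2$ be an integer and let $\tau$ be a real number with $\tau\ge\frac{\log 3}{\log\nu}$ (so $\tau>0$). Consider the alphabet $\mathcal A=\{0,1,\dots,2\nu\}$, call $\mathcal G=\{1,\dots,\nu\}$ the green symbols and $\mathcal Y=\{\nu+1,\dots,2\nu\}$ the yellow symbols. Let $\Sigma\subset\mathcal A^{\mathbb Z}$ be the subshift of all sequences $x$ such that (i) any two coloured (nonzero) symbols of $x$ that are separated by a nonempty finite string containing only zeros have different colours; and (ii) whenever a word $\alpha$ of length $a\ge 1$ of one colour is followed in $x$, after a (possibly empty) finite string $\gamma$ of zeros, by a word $\beta$ of length $b\ge 1$ of the other colour, then $|\gamma|\ge\tau(a+b)$. (In particular an infinite monochromatic string is never followed or preceded by a change of colour.) Thus $\Sigma$ contains the green full shift $\mathcal G^{\mathbb Z}$ and the yellow full shift $\mathcal Y^{\mathbb Z}$. Let $\sigma:\Sigma\to\Sigma$, $\sigma(x)_i=x_{i+1}$, be the shift. Let $\mu_{\mathcal G}$ and $\mu_{\mathcal Y}$ be the measures on $\Sigma$ given by the Bernoulli measures whose coordinates are independent and uniformly distributed on $\mathcal G$, respectively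 on $\mathcal Y$. Then $\sigma$ is topologically mixing, and $\mu_{\mathcal G}$ and $\mu_{\mathcal Y}$ are two mutually singular ergodic measures of maximal entropy for $\sigma$: each is a $\sigma$-invariant ergodic probability measure whose metric entropy equals the topological entropy of $\sigma:\Sigma\to\Sigma$. -/

import Mathlib

open SymbolicDynamics.FullShift MeasureTheory Filter Topology

noncomputable section

/-! ## Dynamics: mixing, metric entropy, measures of maximal entropy -/

/-- A map `T` of a topological space is topologically mixing if for all nonempty open `U`, `V`
one has `U ∩ T⁻ⁿ V ≠ ∅` for all sufficiently large `n`. -/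
def TopologicallyMixing {X : Type*} [TopologicalSpace X] (T : X → X) : Prop :=
  ∀ U V : Set X, IsOpen U → U.Nonempty → IsOpen V → V.Nonempty →
    ∃ N : ℕ, ∀ n : ℕ, N ≤ n → (U ∩ T^[n] ⁻¹' V).Nonempty

/-- Shannon entropy `-∑ₐ μ(P⁻¹ a) log μ(P⁻¹ a)` of the finite partition of `X` into the fibres
of `P : X → ι`. -/
def partitionEntropy {X ι : Type*} [MeasurableSpace X] [Fintype ι] (μ : Measure X)
    (P : X → ι) : ℝ :=
  ∑ a : ι, Real.negMulLog (μ.real (P ⁻¹' {a}))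

/-- The labelling map of the partition `P ∨ T⁻¹P ∨ ⋯ ∨ T⁻⁽ⁿ⁻¹⁾P`. -/
def refinedPartition {X ι : Type*} (T : X → X) (P : X → ι) (n : ℕ) : X → (Fin n → ι) :=
  fun x j => P (T^[j] x)

/-- Entropy of `T` relative to the finite partition `P`: the limit (which exists when `μ` is a
`T`-invariant probability measure) of `H_μ(P ∨ ⋯ ∨ T⁻⁽ⁿ⁻¹⁾P) / n`. -/
def metricEntropyOfPartition {X ι : Type*} [MeasurableSpace X] [Fintype ι] (T : X → X)
    (μ : Measure X) (P : X → ι) : EReal :=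
  limsup (fun n : ℕ => ((partitionEntropy μ (refinedPartition T P n) / n : ℝ) : EReal)) atTop

/-- Metric (Kolmogorov–Sinai) entropy `h_μ(T)`: the supremum over all finite measurable
partitions. -/
def metricEntropy {X : Type*} [MeasurableSpace X] (T : X → X) (μ : Measure X) : EReal :=
  ⨆ (k : ℕ) (P : X → Fin k) (_ : Measurable P), metricEntropyOfPartition T μ P

/-- A measure of maximal entropy: a `T`-invariant probability measure whose metric entropy equals
the topological entropy of `T`. -/
structure IsMeasureOfMaximalEntropy {X : Type*} [UniformSpace X] [MeasurableSpace X]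
    (T : X → X) (μ : Measure X) : Prop where
  isProbabilityMeasure : IsProbabilityMeasure μ
  measurePreserving : MeasurePreserving T μ μ
  metricEntropy_eq : metricEntropy T μ = Dynamics.coverEntropy T Set.univ

/-! ## The subshift -/

/-- The discrete uniformity on a finite alphabet; it induces the discrete topology. -/
instance instUniformSpaceFinAlphabet (n : ℕ) : UniformSpace (Fin n) := ⊥

/-- The green symbols `1, …, ν`. -/
def green (ν : ℕ) : Set (Fin (2 * ν + 1)) := {s | 1 ≤ s.val ∧ s.val ≤ ν}

/-- The yellow symbols `ν + 1, …, 2ν`. -/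
def yellow (ν : ℕ) : Set (Fin (2 * ν + 1)) := {s | ν + 1 ≤ s.val ∧ s.val ≤ 2 * ν}

/-- The word `x_i x_{i+1} ⋯ x_{i+n-1}` of length `n` consists of symbols from `C`. -/
def IsWordIn {A : Type*} (C : Set A) (x : ℤ → A) (i : ℤ) (n : ℕ) : Prop :=
  ∀ k : ℕ, k < n → x (i + k) ∈ C

/-- The admissible sequences.

* `same_colour`: the symbols before and after a nonempty string of zeros do not have the same
  colour, that is, zeros only separate words of different colours (or extend to infinity).
* `change_colour`: if a word of length `a ≥ 1` of one colour is followed, after a (possibly empty)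
  string of `l` zeros, by a word of length `b ≥ 1` of the other colour, then `l ≥ τ (a + b)`.
  The two words range over all lengths: for finite maximal coloured words this is the bound for
  the maximal words, and an infinite coloured word is never followed or preceded by a change of
  colour.

All monochromatic sequences are admissible. -/
structure IsAdmissible (ν : ℕ) (τ : ℝ) (x : ℤ → Fin (2 * ν + 1)) : Prop where
  same_colour : ∀ C : Set (Fin (2 * ν + 1)), (C = green ν ∨ C = yellow ν) →
    ∀ (i : ℤ) (l : ℕ), x i ∈ C → IsWordIn {0} x (i + 1) l → x (i + 1 + l) ∈ C → l = 0
  change_colour : ∀ C D : Set (Fin (2 * ν + 1)),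
    (C = green ν ∧ D = yellow ν ∨ C = yellow ν ∧ D = green ν) →
    ∀ (i : ℤ) (a l b : ℕ), 0 < a → 0 < b →
      IsWordIn C x i a → IsWordIn {0} x (i + a) l → IsWordIn D x (i + a + l) b →
      τ * ((a : ℝ) + b) ≤ l

theorem isClosed_setOf_apply_mem {A : Type*} [TopologicalSpace A] [DiscreteTopology A]
    (C : Set A) (i : ℤ) : IsClosed {x : ℤ → A | x i ∈ C} :=
  (isClosed_discrete C).preimage (continuous_apply i)

theorem isOpen_setOf_apply_mem {A : Type*} [TopologicalSpace A] [DiscreteTopology A]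
    (C : Set A) (i : ℤ) : IsOpen {x : ℤ → A | x i ∈ C} :=
  (isOpen_discrete C).preimage (continuous_apply i)

theorem isOpen_setOf_isWordIn {A : Type*} [TopologicalSpace A] [DiscreteTopology A]
    (C : Set A) (i : ℤ) (n : ℕ) : IsOpen {x : ℤ → A | IsWordIn C x i n} := by
  have h : {x : ℤ → A | IsWordIn C x i n}
      = ⋂ k ∈ Finset.range n, {x : ℤ → A | x (i + (k : ℕ)) ∈ C} := by
    ext x
    simp [IsWordIn]
  rw [h]
  exact isOpen_biInter_finset fun k _ => isOpen_setOf_apply_mem C _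

theorem isClosed_setOf_isAdmissible (ν : ℕ) (τ : ℝ) : IsClosed {x | IsAdmissible ν τ x} := by
  have h : {x | IsAdmissible ν τ x} =
      {x | ∀ C : Set (Fin (2 * ν + 1)), (C = green ν ∨ C = yellow ν) →
        ∀ (i : ℤ) (l : ℕ), x i ∈ C → IsWordIn {0} x (i + 1) l → x (i + 1 + l) ∈ C → l = 0} ∩
      {x | ∀ C D : Set (Fin (2 * ν + 1)),
        (C = green ν ∧ D = yellow ν ∨ C = yellow ν ∧ D = green ν) →
        ∀ (i : ℤ) (a l b : ℕ), 0 < a → 0 < b →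
          IsWordIn C x i a → IsWordIn {0} x (i + a) l → IsWordIn D x (i + a + l) b →
          τ * ((a : ℝ) + b) ≤ l} := by
    ext x
    exact ⟨fun hx => ⟨hx.1, hx.2⟩, fun hx => ⟨hx.1, hx.2⟩⟩
  rw [h]
  refine IsClosed.inter ?_ ?_
  · simp only [Set.ofPred_forall]
    refine isClosed_iInter fun C => isClosed_iInter fun _ => isClosed_iInter fun i =>
      isClosed_iInter fun l => ?_
    exact isClosed_imp (isOpen_setOf_apply_mem C i) <|
      isClosed_imp (isOpen_setOf_isWordIn _ _ _) <|
      isClosed_imp (isOpen_setOf_apply_mem C _) isClosed_const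
  · simp only [Set.ofPred_forall]
    refine isClosed_iInter fun C => isClosed_iInter fun D => isClosed_iInter fun _ =>
      isClosed_iInter fun i => isClosed_iInter fun a => isClosed_iInter fun l =>
      isClosed_iInter fun b => isClosed_iInter fun _ => isClosed_iInter fun _ => ?_
    exact isClosed_imp (isOpen_setOf_isWordIn _ _ _) <|
      isClosed_imp (isOpen_setOf_isWordIn _ _ _) <|
      isClosed_imp (isOpen_setOf_isWordIn _ _ _) isClosed_const

theorem isWordIn_shift {A : Type*} (C : Set A) (x : ℤ → A) (g i : ℤ) (n : ℕ) :
    IsWordIn C (shift g x) i n ↔ IsWordIn C x (g + i) n := by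
  simp [IsWordIn, add_assoc]

theorem IsAdmissible.shift {ν : ℕ} {τ : ℝ} {x : ℤ → Fin (2 * ν + 1)}
    (hx : IsAdmissible ν τ x) (g : ℤ) :
    IsAdmissible ν τ (SymbolicDynamics.FullShift.shift g x) where
  same_colour C hC i l h₁ h₂ h₃ := by
    rw [isWordIn_shift] at h₂
    rw [shift_apply] at h₁ h₃
    refine hx.same_colour C hC (g + i) l h₁ ?_ ?_
    · rwa [add_assoc]
    · rwa [add_assoc, add_assoc, ← add_assoc i]
  change_colour C D hCD i a l b ha hb h₁ h₂ h₃ := by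
    rw [isWordIn_shift] at h₁ h₂ h₃
    refine hx.change_colour C D hCD (g + i) a l b ha hb h₁ ?_ ?_
    · rwa [add_assoc]
    · rwa [add_assoc, add_assoc, ← add_assoc i]

/-- The subshift `Σ` of admissible sequences over the alphabet `{0, 1, …, 2ν}`. -/
def twoColourSubshift (ν : ℕ) (τ : ℝ) : Subshift (Fin (2 * ν + 1)) ℤ where
  carrier := {x | IsAdmissible ν τ x}
  isClosed := isClosed_setOf_isAdmissible ν τ
  mapsTo g _ hx := IsAdmissible.shift hx g

/-- The shift transformation `σ(x)_i = x_{i+1}` of `Σ`. -/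
def twoColourShift (ν : ℕ) (τ : ℝ) :
    (twoColourSubshift ν τ).carrier → (twoColourSubshift ν τ).carrier :=
  ((twoColourSubshift ν τ).mapsTo 1).restrict

/-- The Bernoulli measure on `{0, 1, …, 2ν}^ℤ` whose coordinates are independent and uniformly
distributed on the set of symbols `C`, restricted to the Borel sets of `Σ`. -/
def bernoulliOn (ν : ℕ) (τ : ℝ) (C : Set (Fin (2 * ν + 1))) :
    Measure (twoColourSubshift ν τ).carrier :=
  (Measure.infinitePi fun _ : ℤ => ProbabilityTheory.uniformOn C).comap Subtype.val

end

/-!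
The topological entropy of the subshift is `log ν`, and both Bernoulli measures have metric entropy
`log ν`.

*Topological entropy.* The full shift on one colour class, which has `ν` symbols, lies in the
subshift, so the entropy is at least `log ν` (`le_coverEntropy_twoColourShift`). For the converse,
consider admissible words of length `n` whose first run, of length `a`, has a given colour. Either
at most one run is visible, or that run is followed by `l ≥ τ (a + b)` zeros and a run of length
`b` of the other colour. If `K ν ^ m` bounds the number of such words for every shorter length
`m`, then there are at most `ν ^ n (1 + K ∑_b ∑_{l ≥ τ (a + b)} ν ^ (-l))` of them, and
`ν ^ (-τ) ≤ 1 / 3` makes the double sum at most `1 / 3`. So `K = 3 / 2` is reproduced by the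
induction (`wordCount_runSet_le`), and the number of all admissible words of length `n` is at most
a polynomial in `n` times `ν ^ n` (`wordCount_admissible_le`).

*Metric entropy.* The partition by the symbol at the origin has entropy exactly `log ν`. For an
arbitrary finite partition `P`, let `P'` depend on finitely many coordinates and agree with `P` up
to measure `δ` (`exists_local_approximation`). There are at most `ν ^ (n + O(1))` almost sure
itineraries of `P'`, and an itinerary of `P` is coded by one of `P'` together with letterwise
corrections, at a mean cost per letter that tends to `0` with `δ`. Gibbs' inequality turns the
code length into an upper bound for the entropy (`partitionEntropy_refinedPartition_le`), without
any use of conditional entropy.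

*Ergodicity* holds for every Bernoulli shift: an invariant set `E` is approximated by cylinder sets,
which are independent of their far translates, so `μ E = (μ E) ^ 2`.

*Mixing.* Admissible sequences truncated to finite windows are admissible, and two of them can be
glued along a long enough string of zeros, after the insertion of one symbol of the other colour if
the facing colours agree (`exists_isAdmissible_of_bounded`).
-/

/-! ### Counting words -/

theorem Set.ncard_image_le_ncard_image {α β γ : Type*} {S : Set α} {f : α → β} {g : α → γ}
    (hS : (g '' S).Finite) (h : ∀ x ∈ S, ∀ y ∈ S, g x = g y → f x = f y) :
    (f '' S).ncard ≤ (g '' S).ncard := by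
  rcases S.eq_empty_or_nonempty with rfl | ⟨x₀, -⟩
  · simp
  have : Nonempty α := ⟨x₀⟩
  choose! u hu using fun c (hc : c ∈ g '' S) => hc
  have hsub : f '' S ⊆ (f ∘ u) '' (g '' S) := by
    rintro _ ⟨x, hx, rfl⟩
    have hg := hu _ (Set.mem_image_of_mem g hx)
    exact ⟨g x, Set.mem_image_of_mem g hx, h _ hg.1 _ hx hg.2⟩
  exact (Set.ncard_le_ncard hsub (hS.image _)).trans (Set.ncard_image_le hS)

/-- The number of words `x_i x_{i+1} ⋯ x_{i+n-1}` with `x ∈ S`. -/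
noncomputable def wordCount {A : Type*} (S : Set (ℤ → A)) (i : ℤ) (n : ℕ) : ℕ :=
  ((fun (x : ℤ → A) (k : Fin n) => x (i + k)) '' S).ncard

section WordCount

variable {A : Type*}

theorem wordCount_mono [Finite A] {S T : Set (ℤ → A)} (h : S ⊆ T) (i : ℤ) (n : ℕ) :
    wordCount S i n ≤ wordCount T i n :=
  Set.ncard_le_ncard (Set.image_mono h) (Set.toFinite _)

theorem wordCount_union_le (S T : Set (ℤ → A)) (i : ℤ) (n : ℕ) :
    wordCount (S ∪ T) i n ≤ wordCount S i n + wordCount T i n := by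
  unfold wordCount
  rw [Set.image_union]
  exact Set.ncard_union_le _ _

theorem wordCount_biUnion_le {κ : Type*} (s : Finset κ) (S : κ → Set (ℤ → A)) (i : ℤ) (n : ℕ) :
    wordCount (⋃ j ∈ s, S j) i n ≤ ∑ j ∈ s, wordCount (S j) i n := by
  classical
  induction s using Finset.induction_on with
  | empty => simp [wordCount]
  | insert j s hj ih =>
    rw [Finset.set_biUnion_insert, Finset.sum_insert hj]
    exact (wordCount_union_le _ _ _ _).trans (Nat.add_le_add_left ih _)

theorem wordCount_add_le [Finite A] (S : Set (ℤ → A)) (i : ℤ) (p q : ℕ) :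
    wordCount S i (p + q) ≤ wordCount S i p * wordCount S (i + p) q := by
  unfold wordCount
  rw [← Set.ncard_prod]
  refine Set.ncard_le_ncard_of_injOn
    (fun w => (fun k : Fin p => w (Fin.castAdd q k), fun k : Fin q => w (Fin.natAdd p k)))
    ?_ ?_ (Set.toFinite _)
  · rintro _ ⟨x, hx, rfl⟩
    refine ⟨⟨x, hx, rfl⟩, ⟨x, hx, ?_⟩⟩
    funext k
    simp [add_assoc]
  · intro v _ w _ h
    funext k
    rw [Prod.ext_iff] at h
    refine Fin.addCases (fun k => ?_) (fun k => ?_) k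
    · exact congrFun h.1 k
    · exact congrFun h.2 k

theorem wordCount_le_pow [Finite A] {S : Set (ℤ → A)} {C : Set A} {i : ℤ} {n : ℕ}
    (h : ∀ x ∈ S, IsWordIn C x i n) : wordCount S i n ≤ C.ncard ^ n := by
  have hsub : (fun (x : ℤ → A) (k : Fin n) => x (i + k)) '' S ⊆ Set.univ.pi fun _ => C := by
    rintro _ ⟨x, hx, rfl⟩ k _
    exact h x hx k k.2
  refine (Set.ncard_le_ncard hsub (Set.toFinite _)).trans ?_
  rw [← Nat.card_coe_set_eq, Nat.card_congr (Equiv.Set.univPi fun _ : Fin n => C), Nat.card_pi]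
  simp [Nat.card_coe_set_eq]

end WordCount

/-- The longest initial run of symbols of `C` in the window `[i, i + n)`. -/
theorem exists_maximal_isWordIn {A : Type*} (C : Set A) (x : ℤ → A) (i : ℤ) (n : ℕ) :
    ∃ j ≤ n, IsWordIn C x i j ∧ (j < n → x (i + j) ∉ C) := by
  induction n with
  | zero =>
    exact ⟨0, le_rfl, fun k hk => absurd hk (Nat.not_lt_zero k), fun h => absurd h (lt_irrefl 0)⟩
  | succ n ih =>
    obtain ⟨j, hj, hw, hend⟩ := ih
    by_cases h : j = n ∧ x (i + j) ∈ C
    · obtain ⟨rfl, h⟩ := h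
      refine ⟨j + 1, le_rfl, fun k hk => ?_, fun h => absurd h (lt_irrefl _)⟩
      rcases Nat.lt_succ_iff_lt_or_eq.mp hk with hk | rfl
      · exact hw k hk
      · exact h
    · refine ⟨j, hj.trans n.le_succ, hw, fun _ hC => ?_⟩
      rcases hj.lt_or_eq with hlt | heq
      · exact hend hlt hC
      · exact h ⟨heq, hC⟩

/-! ### Colours -/

/-- The two colour classes, in either order. -/
def IsColourPair (ν : ℕ) (C D : Set (Fin (2 * ν + 1))) : Prop :=
  C = green ν ∧ D = yellow ν ∨ C = yellow ν ∧ D = green ν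

section Colours

variable {ν : ℕ} {C D : Set (Fin (2 * ν + 1))}

theorem IsColourPair.symm (h : IsColourPair ν C D) : IsColourPair ν D C := by
  rcases h with ⟨h₁, h₂⟩ | ⟨h₁, h₂⟩
  · exact Or.inr ⟨h₂, h₁⟩
  · exact Or.inl ⟨h₂, h₁⟩

theorem IsColourPair.colour (h : IsColourPair ν C D) : C = green ν ∨ C = yellow ν :=
  h.imp And.left And.left

theorem isColourPair_of_colour (hC : C = green ν ∨ C = yellow ν) : ∃ D, IsColourPair ν C D :=
  hC.elim (fun h => ⟨_, Or.inl ⟨h, rfl⟩⟩) (fun h => ⟨_, Or.inr ⟨h, rfl⟩⟩)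

theorem IsColourPair.mem_or_mem (h : IsColourPair ν C D) {s : Fin (2 * ν + 1)} (hs : s ≠ 0) :
    s ∈ C ∨ s ∈ D := by
  have h0 : s.val ≠ 0 := fun h => hs (Fin.ext h)
  have := s.2
  rcases h with ⟨rfl, rfl⟩ | ⟨rfl, rfl⟩ <;> simp only [green, yellow, Set.mem_ofPred_eq] <;> omega

theorem IsColourPair.disjoint (h : IsColourPair ν C D) : Disjoint C D := by
  rw [Set.disjoint_left]
  intro s
  rcases h with ⟨rfl, rfl⟩ | ⟨rfl, rfl⟩ <;> simp only [green, yellow, Set.mem_ofPred_eq] <;> omega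

theorem zero_notMem_of_colour (hC : C = green ν ∨ C = yellow ν) : (0 : Fin (2 * ν + 1)) ∉ C := by
  rcases hC with rfl | rfl <;> simp [green, yellow]

theorem ncard_of_colour (hC : C = green ν ∨ C = yellow ν) : C.ncard = ν := by
  have key : ∀ a : ℕ, a ≤ ν →
      ({s | a + 1 ≤ s.val ∧ s.val ≤ a + ν} : Set (Fin (2 * ν + 1))).ncard = ν := by
    intro a ha
    have : ({s | a + 1 ≤ s.val ∧ s.val ≤ a + ν} : Set (Fin (2 * ν + 1)))
        = Set.range fun k : Fin ν => (⟨a + 1 + k, by omega⟩ : Fin (2 * ν + 1)) := by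
      ext s
      simp only [Set.mem_ofPred_eq, Set.mem_range]
      refine ⟨fun h => ⟨⟨s.val - (a + 1), by omega⟩, Fin.ext (by simp; omega)⟩, ?_⟩
      rintro ⟨k, rfl⟩
      have := k.2
      simp only
      omega
    rw [this, ← Set.image_univ, Set.ncard_image_of_injective, Set.ncard_univ, Nat.card_fin]
    intro j k h
    simp only [Fin.mk.injEq] at h
    exact Fin.ext (by omega)
  rcases hC with rfl | rfl
  · simpa [green] using key 0 (Nat.zero_le _)
  · simpa [yellow, two_mul] using key ν le_rfl

end Colours

/-! ### Counting admissible words -/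

/-- The admissible sequences whose initial run of symbols of `C` in the window `[i, i + n)` has
length exactly `a`. For `a = n` the run fills the window and may continue beyond it. -/
def runSet (ν : ℕ) (τ : ℝ) (C : Set (Fin (2 * ν + 1))) (i : ℤ) (n a : ℕ) :
    Set (ℤ → Fin (2 * ν + 1)) :=
  {x | IsAdmissible ν τ x ∧ IsWordIn C x i a ∧ (a < n → x (i + a) ∉ C)}

/-- A first run that ends inside the window is followed by zeros up to the end of the window, or by
a string of zeros that is long compared with the first and the next run, which has the other
colour. -/
theorem runSet_subset {ν : ℕ} {τ : ℝ} {C D : Set (Fin (2 * ν + 1))} (hCD : IsColourPair ν C D)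
    (i : ℤ) {n a : ℕ} (ha : 0 < a) (han : a < n) :
    runSet ν τ C i n a ⊆ {x | IsWordIn C x i a ∧ IsWordIn {0} x (i + a) (n - a)} ∪
      ⋃ b ∈ Finset.Ico 1 (n + 1), ⋃ l ∈ (Finset.range n).filter fun l : ℕ =>
          τ * ((a : ℝ) + b) ≤ l ∧ a + l + b ≤ n,
        {x | IsWordIn C x i a ∧ IsWordIn {0} x (i + a) l} ∩
          runSet ν τ D (i + a + l) (n - a - l) b := by
  rintro x ⟨hx, hC, hend⟩
  obtain ⟨l, hl, h0, hl'⟩ := exists_maximal_isWordIn {0} x (i + a) (n - a)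
  rcases hl.eq_or_lt with rfl | hlt
  · exact Or.inl ⟨hC, h0⟩
  right
  obtain ⟨b, hb, hD, hb'⟩ := exists_maximal_isWordIn D x (i + a + l) (n - a - l)
  have hnD : x (i + a + l) ∈ D := by
    refine (hCD.mem_or_mem (hl' hlt)).resolve_left fun hmem => ?_
    have hlast : x (i + (a - 1 : ℕ)) ∈ C := hC (a - 1) (by omega)
    have e : i + ((a - 1 : ℕ) : ℤ) + 1 = i + a := by omega
    have := hx.same_colour C hCD.colour (i + (a - 1 : ℕ)) l hlast (by rwa [e]) (by rwa [e])
    subst this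
    exact hend han (by simpa using hmem)
  have hb0 : 0 < b := by
    rcases Nat.eq_zero_or_pos b with rfl | h
    · exact absurd (by simpa using hnD) (hb' (by omega))
    · exact h
  have hτ := hx.change_colour C D hCD i a l b ha hb0 hC h0 hD
  simp only [Set.mem_iUnion, Finset.mem_Ico, Finset.mem_filter, Finset.mem_range]
  exact ⟨b, ⟨hb0, by omega⟩, l, ⟨by omega, hτ, by omega⟩, ⟨hC, h0⟩, hx, hD, hb'⟩

theorem sum_Ico_one_third_pow_le (n : ℕ) :
    ∑ b ∈ Finset.Ico 1 n, (1 / 3 : ℝ) ^ b ≤ 1 / 2 := by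
  refine (geom_sum_Ico_le_of_lt_one (by norm_num) (by norm_num)).trans ?_
  norm_num

/-- The tail of a geometric series of ratio at most `1 / 2`, started at a real bound. -/
theorem sum_inv_pow_filter_le {ν : ℕ} (hν : 2 ≤ ν) (t : ℝ) (n : ℕ) :
    ∑ l ∈ (Finset.range n).filter (fun l : ℕ => t ≤ l), ((ν : ℝ)⁻¹) ^ l
      ≤ 2 * (ν : ℝ) ^ (-t) := by
  have hν' : (2 : ℝ) ≤ ν := by exact_mod_cast hν
  have h0 : (0 : ℝ) ≤ (ν : ℝ)⁻¹ := by positivity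
  have h2 : (ν : ℝ)⁻¹ ≤ 1 / 2 := by
    rw [one_div]; exact inv_anti₀ (by norm_num) hν'
  have e : (Finset.range n).filter (fun l : ℕ => t ≤ l) = Finset.Ico ⌈t⌉₊ n := by
    ext l
    simp [and_comm, Nat.ceil_le]
  rw [e]
  refine (geom_sum_Ico_le_of_lt_one h0 (by linarith)).trans ?_
  have h3 : ((ν : ℝ)⁻¹) ^ ⌈t⌉₊ ≤ (ν : ℝ) ^ (-t) := by
    rw [inv_pow, ← Real.rpow_natCast, ← Real.rpow_neg (by positivity)]
    exact Real.rpow_le_rpow_of_exponent_le (by linarith) (neg_le_neg (Nat.le_ceil t))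
  rw [div_le_iff₀ (by linarith)]
  have h4 : 0 ≤ (ν : ℝ) ^ (-t) := by positivity
  nlinarith

/-- The lower bound on `τ` in the form in which it is used. -/
theorem rpow_neg_mul_le {ν : ℕ} (hν : 2 ≤ ν) {τ : ℝ} (hτ : Real.log 3 / Real.log ν ≤ τ) (k : ℕ) :
    (ν : ℝ) ^ (-(τ * k)) ≤ (1 / 3 : ℝ) ^ k := by
  have hν' : (2 : ℝ) ≤ ν := by exact_mod_cast hν
  have hlog : 0 < Real.log ν := Real.log_pos (by linarith)
  rw [div_le_iff₀ hlog] at hτ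
  have h1 : (ν : ℝ) ^ (-τ) ≤ 1 / 3 := by
    rw [← Real.log_le_log_iff (by positivity) (by norm_num), Real.log_rpow (by linarith),
      one_div, Real.log_inv]
    linarith
  rw [← neg_mul, Real.rpow_mul (by positivity), Real.rpow_natCast]
  exact pow_le_pow_left₀ (by positivity) h1 k

theorem tau_pos {ν : ℕ} (hν : 2 ≤ ν) {τ : ℝ} (hτ : Real.log 3 / Real.log ν ≤ τ) : 0 < τ :=
  (div_pos (Real.log_pos (by norm_num))
    (Real.log_pos (by exact_mod_cast (by omega : 1 < ν)))).trans_le hτ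

/-- The constant `3 / 2` is the solution of `1 + K / 3 = K`: the words without a second run
contribute at most `1`, and the others at most `K / 3`, in units of `ν ^ n`. -/
theorem wordCount_runSet_le {ν : ℕ} (hν : 2 ≤ ν) {τ : ℝ} (hτ : Real.log 3 / Real.log ν ≤ τ) (n : ℕ)
    {C D : Set (Fin (2 * ν + 1))} (hCD : IsColourPair ν C D) (i : ℤ) {a : ℕ} (ha : 0 < a)
    (han : a ≤ n) : (wordCount (runSet ν τ C i n a) i n : ℝ) ≤ 3 / 2 * (ν : ℝ) ^ n := by
  have hν' : (2 : ℝ) ≤ ν := by exact_mod_cast hν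
  induction n using Nat.strong_induction_on generalizing C D i a with
  | _ n ih =>
    have hC := ncard_of_colour hCD.colour
    have hpos : (0 : ℝ) < (ν : ℝ) ^ n := by positivity
    rcases han.eq_or_lt with rfl | hlt
    · have h : wordCount (runSet ν τ C i a a) i a ≤ ν ^ a := by
        simpa only [hC] using wordCount_le_pow (C := C) fun x hx => hx.2.1
      have h' : (wordCount (runSet ν τ C i a a) i a : ℝ) ≤ (ν : ℝ) ^ a := by exact_mod_cast h
      linarith
    have hprefix : ∀ l : ℕ, wordCount {x : ℤ → Fin (2 * ν + 1) |
        IsWordIn C x i a ∧ IsWordIn {0} x (i + a) l} i (a + l) ≤ ν ^ a := by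
      intro l
      refine (wordCount_add_le _ _ _ _).trans ?_
      refine (Nat.mul_le_mul (wordCount_le_pow (C := C) fun x hx => hx.1)
        (wordCount_le_pow (C := {0}) fun x hx => hx.2)).trans ?_
      simp [hC]
    -- A string of `l` zeros after the first run costs a factor `ν ^ (-l)`.
    have hterm : ∀ b l : ℕ, 0 < b → a + l + b ≤ n →
        (wordCount ({x | IsWordIn C x i a ∧ IsWordIn {0} x (i + a) l} ∩
          runSet ν τ D (i + a + l) (n - a - l) b) i n : ℝ)
        ≤ 3 / 2 * (ν : ℝ) ^ n * ((ν : ℝ)⁻¹) ^ l := by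
      intro b l hb hle
      set S := {x | IsWordIn C x i a ∧ IsWordIn {0} x (i + a) l} ∩
          runSet ν τ D (i + a + l) (n - a - l) b with hS
      have e : n = (a + l) + (n - a - l) := by omega
      have h1 : wordCount S i n ≤ wordCount S i (a + l) *
          wordCount S (i + a + l) (n - a - l) := by
        conv_lhs => rw [e]
        refine (wordCount_add_le _ _ _ _).trans (le_of_eq ?_)
        push_cast
        rw [← add_assoc]
      have h2 : wordCount S i (a + l) ≤ ν ^ a :=
        (wordCount_mono Set.inter_subset_left _ _).trans (hprefix l)
      have h3 := ih (n - a - l) (by omega) hCD.symm (i + a + l) hb (by omega)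
      have h4 : (wordCount S (i + a + l) (n - a - l) : ℝ) ≤ 3 / 2 * (ν : ℝ) ^ (n - a - l) :=
        le_trans (by exact_mod_cast wordCount_mono Set.inter_subset_right _ _) h3
      calc (wordCount S i n : ℝ)
          ≤ (wordCount S i (a + l) : ℝ) * wordCount S (i + a + l) (n - a - l) := by
            exact_mod_cast h1
        _ ≤ (ν : ℝ) ^ a * (3 / 2 * (ν : ℝ) ^ (n - a - l)) :=
            mul_le_mul (by exact_mod_cast h2) h4 (by positivity) (by positivity)
        _ = 3 / 2 * (ν : ℝ) ^ n * ((ν : ℝ)⁻¹) ^ l := by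
            conv_rhs => rw [e]
            rw [pow_add, pow_add, inv_pow]
            field_simp
    have hcount : (wordCount (runSet ν τ C i n a) i n : ℝ) ≤ (ν : ℝ) ^ n +
        ∑ b ∈ Finset.Ico 1 (n + 1), ∑ l ∈ (Finset.range n).filter fun l : ℕ =>
          τ * ((a : ℝ) + b) ≤ l ∧ a + l + b ≤ n, 3 / 2 * (ν : ℝ) ^ n * ((ν : ℝ)⁻¹) ^ l := by
      have h1 := (wordCount_mono (runSet_subset (τ := τ) hCD i ha hlt) i n).trans
        ((wordCount_union_le _ _ _ _).trans (Nat.add_le_add_left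
          ((wordCount_biUnion_le _ _ _ _).trans
            (Finset.sum_le_sum fun b _ => wordCount_biUnion_le _ _ _ _)) _))
      have h2 : wordCount {x : ℤ → Fin (2 * ν + 1) |
          IsWordIn C x i a ∧ IsWordIn {0} x (i + a) (n - a)} i n ≤ ν ^ n := by
        have := hprefix (n - a)
        rw [Nat.add_sub_cancel' hlt.le] at this
        exact this.trans (Nat.pow_le_pow_right (by omega) hlt.le)
      refine le_trans (Nat.cast_le.mpr h1) ?_
      push_cast
      refine add_le_add (by exact_mod_cast h2) (Finset.sum_le_sum fun b hb =>
        Finset.sum_le_sum fun l hl => ?_)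
      exact hterm b l (Finset.mem_Ico.mp hb).1 (Finset.mem_filter.mp hl).2.2
    -- Summation over `l`, with `ν ^ (-τ (a + b)) ≤ 3 ^ (-(a + b))` and `a ≥ 1`.
    have hinner : ∀ b ∈ Finset.Ico 1 (n + 1), ∑ l ∈ (Finset.range n).filter fun l : ℕ =>
          τ * ((a : ℝ) + b) ≤ l ∧ a + l + b ≤ n, 3 / 2 * (ν : ℝ) ^ n * ((ν : ℝ)⁻¹) ^ l
        ≤ (ν : ℝ) ^ n * (1 / 3 : ℝ) ^ b := by
      intro b _
      have h1 : ∑ l ∈ (Finset.range n).filter fun l : ℕ =>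
          τ * ((a : ℝ) + b) ≤ l ∧ a + l + b ≤ n, ((ν : ℝ)⁻¹) ^ l
          ≤ 2 * (ν : ℝ) ^ (-(τ * ((a : ℝ) + b))) := by
        refine le_trans (Finset.sum_le_sum_of_subset_of_nonneg ?_ fun _ _ _ => by positivity)
          (sum_inv_pow_filter_le hν _ n)
        exact Finset.monotone_filter_right _ fun l _ h => h.1
      have h2 := rpow_neg_mul_le hν hτ (a + b)
      have h3 : (1 / 3 : ℝ) ^ a ≤ 1 / 3 := by
        simpa using pow_le_pow_of_le_one (by norm_num : (0 : ℝ) ≤ 1 / 3) (by norm_num) ha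
      have h4 : (0 : ℝ) ≤ (1 / 3) ^ b := by positivity
      rw [pow_add] at h2
      push_cast at h2
      have h5 : ∑ l ∈ (Finset.range n).filter fun l : ℕ =>
          τ * ((a : ℝ) + b) ≤ l ∧ a + l + b ≤ n, ((ν : ℝ)⁻¹) ^ l ≤ 2 / 3 * (1 / 3) ^ b := by
        nlinarith
      rw [← Finset.mul_sum]
      nlinarith
    refine hcount.trans ?_
    have h1 := Finset.sum_le_sum hinner
    rw [← Finset.mul_sum] at h1
    have h2 := sum_Ico_one_third_pow_le (n + 1)
    nlinarith

/-- The number of admissible words of length `n` is at most a polynomial in `n` times `ν ^ n`. -/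
theorem wordCount_admissible_le {ν : ℕ} (hν : 2 ≤ ν) {τ : ℝ} (hτ : Real.log 3 / Real.log ν ≤ τ)
    (i : ℤ) (n : ℕ) :
    (wordCount {x | IsAdmissible ν τ x} i n : ℝ) ≤ 4 * ((n : ℝ) + 1) ^ 2 * (ν : ℝ) ^ n := by
  have hν' : (2 : ℝ) ≤ ν := by exact_mod_cast hν
  set S : Set (Fin (2 * ν + 1)) → ℕ → ℕ → Set (ℤ → Fin (2 * ν + 1)) := fun C j a =>
    {x | IsWordIn {0} x i j} ∩ runSet ν τ C (i + j) (n - j) a with hS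
  -- The words are sorted by the number `j` of initial zeros and by the first run.
  have hsub : {x | IsAdmissible ν τ x} ⊆ {x | IsWordIn {0} x i n} ∪
      ⋃ j ∈ Finset.range n, ⋃ a ∈ Finset.Ico 1 (n - j + 1),
        (S (green ν) j a ∪ S (yellow ν) j a) := by
    intro x hx
    obtain ⟨j, hj, h0, hj'⟩ := exists_maximal_isWordIn {0} x i n
    rcases hj.eq_or_lt with rfl | hlt
    · exact Or.inl h0
    right
    simp only [Set.mem_iUnion, Finset.mem_Ico, Finset.mem_range]
    have key : ∀ C, x (i + j) ∈ C → ∃ a, (1 ≤ a ∧ a < n - j + 1) ∧ x ∈ S C j a := by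
      intro C hC
      obtain ⟨a, ha, hw, ha'⟩ := exists_maximal_isWordIn C x (i + j) (n - j)
      refine ⟨a, ⟨?_, by omega⟩, h0, hx, hw, ha'⟩
      rcases Nat.eq_zero_or_pos a with rfl | h
      · exact absurd (by simpa using hC) (ha' (by omega))
      · exact h
    rcases IsColourPair.mem_or_mem (Or.inl ⟨rfl, rfl⟩) (hj' hlt) with h | h
    · obtain ⟨a, ha, hmem⟩ := key _ h
      exact ⟨j, hlt, a, ha, Or.inl hmem⟩
    · obtain ⟨a, ha, hmem⟩ := key _ h
      exact ⟨j, hlt, a, ha, Or.inr hmem⟩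
  have hterm : ∀ C D, IsColourPair ν C D → ∀ j < n, ∀ a ∈ Finset.Ico 1 (n - j + 1),
      (wordCount (S C j a) i n : ℝ) ≤ 3 / 2 * (ν : ℝ) ^ n := by
    intro C D hCD j hj a ha
    rw [Finset.mem_Ico] at ha
    have e : n = j + (n - j) := by omega
    have h1 : wordCount (S C j a) i n ≤
        1 * wordCount (runSet ν τ C (i + j) (n - j) a) (i + j) (n - j) := by
      conv_lhs => rw [e]
      refine (wordCount_add_le _ _ _ _).trans (Nat.mul_le_mul ?_
        (wordCount_mono Set.inter_subset_right _ _))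
      simpa using wordCount_le_pow (S := S C j a) (C := {0}) (i := i) (n := j) fun x hx => hx.1
    have h2 := wordCount_runSet_le hν hτ (n - j) hCD (i + j) (a := a) (by omega) (by omega)
    have h3 : (ν : ℝ) ^ (n - j) ≤ (ν : ℝ) ^ n := pow_le_pow_right₀ (by linarith) (Nat.sub_le _ _)
    rw [one_mul] at h1
    have h4 : (wordCount (S C j a) i n : ℝ) ≤
      wordCount (runSet ν τ C (i + j) (n - j) a) (i + j) (n - j) := by exact_mod_cast h1
    linarith
  have h0 : wordCount {x : ℤ → Fin (2 * ν + 1) | IsWordIn {0} x i n} i n ≤ 1 := by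
    simpa using wordCount_le_pow (S := {x : ℤ → Fin (2 * ν + 1) | IsWordIn {0} x i n})
      (C := {0}) (i := i) (n := n) fun x hx => hx
  have h1 := (wordCount_mono hsub i n).trans
    ((wordCount_union_le _ _ _ _).trans (Nat.add_le_add h0
      ((wordCount_biUnion_le _ _ _ _).trans
        (Finset.sum_le_sum fun j _ => (wordCount_biUnion_le _ _ _ _).trans
          (Finset.sum_le_sum fun a _ => wordCount_union_le _ _ _ _)))))
  have h2 : (wordCount {x | IsAdmissible ν τ x} i n : ℝ) ≤ 1 +
      ∑ j ∈ Finset.range n, ∑ a ∈ Finset.Ico 1 (n - j + 1), 3 * (ν : ℝ) ^ n := by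
    refine le_trans (Nat.cast_le.mpr h1) ?_
    push_cast
    gcongr with j hj a ha
    have h3 := hterm _ _ (Or.inl ⟨rfl, rfl⟩) j (Finset.mem_range.mp hj) a ha
    have h4 := hterm _ _ (Or.inr ⟨rfl, rfl⟩) j (Finset.mem_range.mp hj) a ha
    linarith
  have hpow : (1 : ℝ) ≤ (ν : ℝ) ^ n := one_le_pow₀ (by linarith)
  have h3 : ∑ j ∈ Finset.range n, ∑ a ∈ Finset.Ico 1 (n - j + 1), 3 * (ν : ℝ) ^ n
      ≤ ∑ j ∈ Finset.range n, n * (3 * (ν : ℝ) ^ n) := by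
    refine Finset.sum_le_sum fun j _ => ?_
    rw [Finset.sum_const, Nat.card_Ico, nsmul_eq_mul]
    gcongr
    omega
  rw [Finset.sum_const, Finset.card_range, nsmul_eq_mul] at h3
  have hn : (0 : ℝ) ≤ n := Nat.cast_nonneg n
  nlinarith [mul_nonneg hn (zero_le_one.trans hpow),
    mul_nonneg (mul_nonneg hn hn) (zero_le_one.trans hpow)]

/-! ### Topological entropy -/

theorem isAdmissible_of_forall_mem {ν : ℕ} {τ : ℝ} {C : Set (Fin (2 * ν + 1))}
    (hC : C = green ν ∨ C = yellow ν) {x : ℤ → Fin (2 * ν + 1)} (hx : ∀ i, x i ∈ C) :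
    IsAdmissible ν τ x where
  same_colour C' _ i l _ h0 _ := by
    rcases Nat.eq_zero_or_pos l with h | h
    · exact h
    · have h1 : x (i + 1 + (0 : ℕ)) = 0 := h0 0 h
      exact absurd (h1 ▸ hx _) (zero_notMem_of_colour hC)
  change_colour C' D' hCD i a l b ha hb hwC _ hwD := by
    have h1 : x (i + (0 : ℕ)) ∈ C' := hwC 0 ha
    have h2 : x (i + a + l + (0 : ℕ)) ∈ D' := hwD 0 hb
    have hC' : C = C' ∨ C = D' := by
      rcases hC with rfl | rfl <;> rcases hCD with ⟨rfl, rfl⟩ | ⟨rfl, rfl⟩ <;> simp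
    rcases hC' with rfl | rfl
    · exact absurd h2 (Set.disjoint_left.mp (IsColourPair.disjoint hCD) (hx _))
    · exact absurd (hx _) (Set.disjoint_left.mp (IsColourPair.disjoint hCD) h1)

theorem twoColourShift_iterate_apply {ν : ℕ} {τ : ℝ} (x : (twoColourSubshift ν τ).carrier) (n : ℕ)
    (i : ℤ) : ((twoColourShift ν τ)^[n] x).1 i = x.1 (n + i) := by
  induction n generalizing x with
  | zero => simp
  | succ n ih =>
    rw [Function.iterate_succ_apply, ih]
    change x.1 (1 + (n + i)) = x.1 ((n + 1 : ℕ) + i)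
    refine congrArg x.1 ?_
    push_cast
    ring

/-- Two points of a subshift are uniformly close as soon as they agree on a large window. -/
theorem exists_window_of_mem_uniformity {k : ℕ} {S : Set (ℤ → Fin k)} {U : Set (S × S)}
    (hU : U ∈ uniformity S) :
    ∃ m : ℕ, ∀ x y : S, (∀ i : ℤ, -(m : ℤ) ≤ i → i ≤ m → x.1 i = y.1 i) → (x, y) ∈ U := by
  rw [uniformity_subtype, Pi.uniformity] at hU
  obtain ⟨V, hV, hVU⟩ := Filter.mem_comap.mp hU
  have hdisc : uniformity (Fin k) = 𝓟 SetRel.id := rfl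
  simp only [hdisc, comap_principal] at hV
  obtain ⟨t, ht, htV⟩ := (hasBasis_iInf_principal_finite _).mem_iff.mp hV
  refine ⟨ht.toFinset.sup Int.natAbs, fun x y hxy => hVU (htV ?_)⟩
  simp only [Set.mem_iInter, Set.mem_preimage]
  intro i hi
  have h1 : i.natAbs ≤ ht.toFinset.sup Int.natAbs := Finset.le_sup (by simpa using hi)
  exact hxy i (by omega) (by omega)

theorem tendsto_log_quadratic_mul_pow_div {ν : ℕ} (hν : 2 ≤ ν) (c : ℕ) :
    Tendsto (fun n : ℕ => Real.log (4 * (((n + c : ℕ) : ℝ) + 1) ^ 2 * (ν : ℝ) ^ (n + c)) / n) atTop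
      (𝓝 (Real.log ν)) := by
  have hν' : (2 : ℝ) ≤ ν := by exact_mod_cast hν
  have h1 : Tendsto (fun n : ℕ => Real.log ((n : ℝ) + (c + 1)) / n) atTop (𝓝 0) := by
    have h := (Real.isLittleO_log_id_atTop.tendsto_div_nhds_zero).comp
      (tendsto_natCast_atTop_atTop.atTop_add
        (tendsto_const_nhds (x := ((c : ℝ) + 1)) (f := (atTop : Filter ℕ))))
    have h' : Tendsto (fun n : ℕ => ((n : ℝ) + (c + 1)) / n) atTop (𝓝 1) := by
      have : Tendsto (fun n : ℕ => 1 + ((c : ℝ) + 1) / n) atTop (𝓝 (1 + 0)) :=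
        tendsto_const_nhds.add (tendsto_const_div_atTop_nhds_zero_nat _)
      rw [add_zero] at this
      refine this.congr' ?_
      filter_upwards [eventually_gt_atTop 0] with n hn
      field_simp
    have := h.mul h'
    rw [zero_mul] at this
    refine this.congr' ?_
    filter_upwards [eventually_gt_atTop 0] with n hn
    have : (0 : ℝ) < (n : ℝ) + (c + 1) := by positivity
    simp only [Function.comp, id]
    field_simp
  have h2 : Tendsto (fun n : ℕ => (Real.log 4 + c * Real.log ν) / n +
      2 * (Real.log ((n : ℝ) + (c + 1)) / n) + Real.log ν) atTop
      (𝓝 (0 + 2 * 0 + Real.log ν)) :=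
    ((tendsto_const_div_atTop_nhds_zero_nat _).add (h1.const_mul 2)).add tendsto_const_nhds
  simp only [mul_zero, zero_add] at h2
  refine h2.congr' ?_
  filter_upwards [eventually_gt_atTop 0] with n hn
  have hpos : (0 : ℝ) < (n : ℝ) + (c + 1) := by positivity
  have e : (((n + c : ℕ) : ℝ) + 1) = (n : ℝ) + (c + 1) := by push_cast; ring
  rw [e, Real.log_mul (by positivity) (by positivity), Real.log_mul (by positivity) (by positivity),
    Real.log_pow, Real.log_pow]
  push_cast
  field_simp
  ring

theorem expGrowthSup_le_log {ν : ℕ} (hν : 2 ≤ ν) (c : ℕ) {u : ℕ → ENNReal}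
    (hu : ∀ n, u n ≤ ENNReal.ofReal (4 * (((n + c : ℕ) : ℝ) + 1) ^ 2 * (ν : ℝ) ^ (n + c))) :
    ExpGrowth.expGrowthSup u ≤ (Real.log ν : EReal) := by
  have hν' : (2 : ℝ) ≤ ν := by exact_mod_cast hν
  have h := (continuous_coe_real_ereal.tendsto _).comp (tendsto_log_quadratic_mul_pow_div hν c)
  rw [ExpGrowth.expGrowthSup_def, ← h.limsup_eq]
  refine limsup_le_limsup (Eventually.of_forall fun n => ?_)
  have h1 := ENNReal.log_monotone (hu n)
  rw [ENNReal.log_ofReal_of_pos (by positivity)] at h1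
  simp only [Function.comp]
  rw [EReal.coe_div]
  exact EReal.div_le_div_right_of_nonneg (by exact_mod_cast n.zero_le) h1

theorem coverEntropy_twoColourShift_le {ν : ℕ} (hν : 2 ≤ ν) {τ : ℝ}
    (hτ : Real.log 3 / Real.log ν ≤ τ) :
    Dynamics.coverEntropy (twoColourShift ν τ) Set.univ ≤ (Real.log ν : EReal) := by
  refine iSup₂_le fun U hU => ?_
  obtain ⟨m, hm⟩ := exists_window_of_mem_uniformity hU
  refine expGrowthSup_le_log hν (2 * m + 1) fun n => ?_
  -- One point is chosen for each word over the window seen by the first `n` iterates.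
  set N := n + (2 * m + 1) with hN
  set W := (fun (x : ℤ → Fin (2 * ν + 1)) (k : Fin N) => x (-(m : ℤ) + k)) ''
    {x | IsAdmissible ν τ x} with hW
  have hWfin : W.Finite := Set.toFinite _
  have hrep : ∀ w ∈ W, ∃ x : (twoColourSubshift ν τ).carrier,
      (fun k : Fin N => x.1 (-(m : ℤ) + k)) = w := by
    rintro _ ⟨x, hx, rfl⟩
    exact ⟨⟨x, hx⟩, rfl⟩
  have : Nonempty (twoColourSubshift ν τ).carrier :=
    ⟨⟨fun _ => ⟨1, by omega⟩, isAdmissible_of_forall_mem (Or.inl rfl)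
      fun _ => ⟨le_rfl, by simp; omega⟩⟩⟩
  choose! f hf using hrep
  classical
  set s : Finset (twoColourSubshift ν τ).carrier :=
    hWfin.toFinset.image f with hs
  have hcov : Dynamics.IsDynCoverOf (twoColourShift ν τ) Set.univ U n s := by
    intro x _
    have hx : (fun k : Fin N => x.1 (-(m : ℤ) + k)) ∈ W := ⟨x.1, x.2, rfl⟩
    refine ⟨f _, Finset.mem_coe.mpr (Finset.mem_image_of_mem f (hWfin.mem_toFinset.mpr hx)), ?_⟩
    · rw [Dynamics.mem_dynEntourage]
      intro k hk
      refine hm _ _ fun i hi hi' => ?_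
      rw [twoColourShift_iterate_apply, twoColourShift_iterate_apply]
      have h := congrFun (hf _ hx) ⟨(k + i + m).toNat, by omega⟩
      have e : -(m : ℤ) + ((k + i + m).toNat : ℤ) = k + i := by omega
      simp only [e] at h
      exact h.symm
  have hcard : s.card ≤ wordCount {x | IsAdmissible ν τ x} (-(m : ℤ)) N := by
    refine Finset.card_image_le.trans ?_
    rw [← Set.ncard_eq_toFinset_card W hWfin]
    rfl
  have h1 := wordCount_admissible_le hν hτ (-(m : ℤ)) N
  calc ((Dynamics.coverMincard (twoColourShift ν τ) Set.univ U n : ℕ∞) : ENNReal)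
      ≤ ((s.card : ℕ∞) : ENNReal) := ENat.toENNReal_mono hcov.coverMincard_le_card
    _ = ENNReal.ofReal (s.card : ℝ) := by simp
    _ ≤ _ := ENNReal.ofReal_le_ofReal (le_trans (by exact_mod_cast hcard) h1)

theorem le_coverEntropy_twoColourShift {ν : ℕ} (hν : 2 ≤ ν) (τ : ℝ) :
    (Real.log ν : EReal) ≤ Dynamics.coverEntropy (twoColourShift ν τ) Set.univ := by
  classical
  set U : Set ((twoColourSubshift ν τ).carrier × (twoColourSubshift ν τ).carrier) :=
    {p | p.1.1 0 = p.2.1 0} with hUdef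
  have hU : U ∈ uniformity (twoColourSubshift ν τ).carrier := by
    have h1 : UniformContinuous fun x : (twoColourSubshift ν τ).carrier => x.1 0 :=
      (Pi.uniformContinuous_proj _ 0).comp uniformContinuous_subtype_val
    have h2 : (SetRel.id : Set (Fin (2 * ν + 1) × Fin (2 * ν + 1))) ∈
        uniformity (Fin (2 * ν + 1)) := mem_principal_self _
    exact h1 h2
  have h1mem : (⟨1, by omega⟩ : Fin (2 * ν + 1)) ∈ green ν := ⟨le_rfl, by simp; omega⟩
  have key : ∀ n : ℕ, ((ν : ENNReal) ^ n) ≤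
      ((Dynamics.netMaxcard (twoColourShift ν τ) Set.univ U n : ℕ∞) : ENNReal) := by
    intro n
    -- The separated points are the green words, extended by the constant symbol `1`.
    let g : (Fin n → green ν) → (twoColourSubshift ν τ).carrier := fun v =>
      ⟨fun i => if h : 0 ≤ i ∧ i < n then (v ⟨i.toNat, by omega⟩).1 else ⟨1, by omega⟩,
        isAdmissible_of_forall_mem (Or.inl rfl) fun i => by
          split_ifs
          · exact Subtype.prop _
          · exact h1mem⟩
    have hg : ∀ v (k : Fin n), (g v).1 k = (v k).1 := by
      intro v k
      have : (0 : ℤ) ≤ (k : ℕ) ∧ ((k : ℕ) : ℤ) < n := ⟨by positivity, by exact_mod_cast k.2⟩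
      simp [g]
    have hsep : ∀ v w z,
        z ∈ UniformSpace.ball (g v) (Dynamics.dynEntourage (twoColourShift ν τ) U n) →
        z ∈ UniformSpace.ball (g w) (Dynamics.dynEntourage (twoColourShift ν τ) U n) → v = w := by
      intro v w z hv hw
      rw [Dynamics.mem_ball_dynEntourage] at hv hw
      funext k
      have h1 : ((twoColourShift ν τ)^[k] (g v)).1 0 = ((twoColourShift ν τ)^[k] z).1 0 := hv k k.2
      have h2 : ((twoColourShift ν τ)^[k] (g w)).1 0 = ((twoColourShift ν τ)^[k] z).1 0 := hw k k.2
      rw [← h2, twoColourShift_iterate_apply, twoColourShift_iterate_apply, add_zero, hg, hg] at h1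
      exact Subtype.ext h1
    have hinj : Function.Injective g := fun v w h => by
      refine hsep v w (g v) ?_ (h ▸ ?_) <;> rw [Dynamics.mem_ball_dynEntourage] <;>
        exact fun _ _ => rfl
    have hnet : Dynamics.IsDynNetIn (twoColourShift ν τ) Set.univ U n
        ((Finset.univ.image g : Finset _) : Set _) := by
      refine ⟨Set.subset_univ _, ?_⟩
      intro x hx y hy hxy
      simp only [Finset.coe_image, Finset.coe_univ, Set.image_univ, Set.mem_range] at hx hy
      obtain ⟨v, rfl⟩ := hx
      obtain ⟨w, rfl⟩ := hy
      rw [Function.onFun, Set.disjoint_left]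
      intro z hv hw
      exact hxy (congrArg g (hsep v w z hv hw))
    have hcard : (Finset.univ.image g).card = ν ^ n := by
      rw [Finset.card_image_of_injective _ hinj, Finset.card_univ, Fintype.card_fun,
        Fintype.card_fin, ← Nat.card_eq_fintype_card, Nat.card_coe_set_eq, ncard_of_colour (Or.inl rfl)]
    have := ENat.toENNReal_mono hnet.card_le_netMaxcard
    rw [hcard] at this
    simpa using this
  calc (Real.log ν : EReal) = ENNReal.log (ν : ENNReal) := by
        rw [← ENNReal.ofReal_natCast, ENNReal.log_ofReal_of_pos (by positivity)]
    _ = ExpGrowth.expGrowthSup (fun n => (ν : ENNReal) ^ n) := ExpGrowth.expGrowthSup_pow.symm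
    _ ≤ Dynamics.netEntropyEntourage (twoColourShift ν τ) Set.univ U :=
        ExpGrowth.expGrowthSup_monotone key
    _ ≤ _ := Dynamics.netEntropyEntourage_le_coverEntropy _ _ hU

theorem coverEntropy_twoColourShift {ν : ℕ} (hν : 2 ≤ ν) {τ : ℝ}
    (hτ : Real.log 3 / Real.log ν ≤ τ) :
    Dynamics.coverEntropy (twoColourShift ν τ) Set.univ = (Real.log ν : EReal) :=
  (coverEntropy_twoColourShift_le hν hτ).antisymm (le_coverEntropy_twoColourShift hν τ)

/-! ### Bernoulli shifts are ergodic -/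

section BernoulliShift

open scoped symmDiff

theorem shift_iterate_apply {A : Type*} (x : ℤ → A) (n : ℕ) (i : ℤ) :
    (shift (1 : ℤ))^[n] x i = x (n + i) := by
  induction n generalizing x with
  | zero => simp
  | succ n ih =>
    rw [Function.iterate_succ_apply, ih, shift_apply]
    refine congrArg x ?_
    push_cast
    ring

variable {A : Type*} [MeasurableSpace A] (p : Measure A) [IsProbabilityMeasure p]

theorem measurePreserving_shift_infinitePi :
    MeasurePreserving (shift (1 : ℤ)) (Measure.infinitePi fun _ : ℤ => p)
      (Measure.infinitePi fun _ : ℤ => p) where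
  measurable := measurable_pi_lambda _ fun i => measurable_pi_apply _
  map_eq := by
    have h := Measure.infinitePi_map_piCongrLeft (fun _ : ℤ => p) (Equiv.addLeft (-1 : ℤ))
    have e : (MeasurableEquiv.piCongrLeft (fun _ : ℤ => A) (Equiv.addLeft (-1 : ℤ)) :
        (ℤ → A) → ℤ → A) = shift (1 : ℤ) := by
      funext x i
      obtain ⟨j, rfl⟩ := (Equiv.addLeft (-1 : ℤ)).surjective i
      rw [MeasurableEquiv.coe_piCongrLeft, Equiv.piCongrLeft_apply_apply]
      simp
    rw [← e]
    exact h

theorem exists_cylinder_measureReal_symmDiff_lt {E : Set (ℤ → A)} (hE : MeasurableSet E) {ε : ℝ}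
    (hε : 0 < ε) : ∃ (s : Finset ℤ) (S : Set (s → A)), MeasurableSet S ∧
      (Measure.infinitePi fun _ : ℤ => p).real (MeasureTheory.cylinder s S ∆ E) < ε := by
  obtain ⟨B, hB, hlt⟩ := exists_measure_symmDiff_lt_of_generateFrom_isSetRing
    (μ := Measure.infinitePi fun _ : ℤ => p) (C := measurableCylinders fun _ : ℤ => A)
    isSetRing_measurableCylinders
    ⟨{Set.univ}, Set.countable_singleton _, by
      rintro _ rfl; exact univ_mem_measurableCylinders _, by simp⟩
    generateFrom_measurableCylinders.symm hE (ENNReal.ofReal_pos.mpr hε)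
  obtain ⟨s, S, hS, rfl⟩ := (mem_measurableCylinders B).mp hB
  exact ⟨s, S, hS, (ENNReal.toReal_lt_toReal (measure_ne_top _ _) ENNReal.ofReal_ne_top).mpr hlt
    |>.trans_eq (ENNReal.toReal_ofReal hε.le)⟩

/-- A cylinder set is independent of some translate of itself. -/
theorem exists_measureReal_cylinder_inter_preimage (s : Finset ℤ) {S : Set (s → A)}
    (hS : MeasurableSet S) : ∃ n : ℕ, (Measure.infinitePi fun _ : ℤ => p).real
      (MeasureTheory.cylinder s S ∩ (shift (1 : ℤ))^[n] ⁻¹' MeasureTheory.cylinder s S) =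
      (Measure.infinitePi fun _ : ℤ => p).real (MeasureTheory.cylinder s S) ^ 2 := by
  -- A translation by more than the diameter of `s` makes `s` and its translate disjoint.
  set n : ℕ := 2 * s.sup Int.natAbs + 1 with hn
  have hbound : ∀ i ∈ s, i.natAbs ≤ s.sup Int.natAbs := fun i hi => Finset.le_sup hi
  set t : Finset ℤ := s.map (addLeftEmbedding (n : ℤ)) with ht
  have hmem : ∀ i : s, (n : ℤ) + i ∈ t := fun i => Finset.mem_map_of_mem _ i.2
  have hdisj : Disjoint s t := by
    rw [Finset.disjoint_left]
    intro i hi hit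
    obtain ⟨j, hj, rfl⟩ := Finset.mem_map.mp hit
    have h1 := hbound _ hi
    have h2 := hbound j hj
    simp only [addLeftEmbedding_apply] at h1
    omega
  have hind := (ProbabilityTheory.iIndepFun_infinitePi (P := fun _ : ℤ => p) (X := fun _ a => a)
    fun _ => measurable_id).indepFun_finset s t hdisj fun i => measurable_pi_apply i
  set S' : Set (t → A) := {w | (fun i : s => w ⟨n + i, hmem i⟩) ∈ S} with hS'
  have hS'm : MeasurableSet S' :=
    hS.preimage (measurable_pi_lambda _ fun i => measurable_pi_apply _)
  have hpre : (shift (1 : ℤ))^[n] ⁻¹' MeasureTheory.cylinder s S =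
      (fun (x : ℤ → A) (i : t) => x i) ⁻¹' S' := by
    ext x
    simp only [Set.mem_preimage, MeasureTheory.mem_cylinder, hS', Set.mem_ofPred_eq]
    refine iff_of_eq (congrArg (· ∈ S) (funext fun i => ?_))
    exact shift_iterate_apply x n i
  have hmul := hind.measure_inter_preimage_eq_mul S S' hS hS'm
  have hinv := ((measurePreserving_shift_infinitePi p).iterate n).measure_preimage
    (hS.cylinder (s := s)).nullMeasurableSet
  refine ⟨n, ?_⟩
  rw [← hpre, hinv] at hmul
  rw [measureReal_def, measureReal_def, sq, ← ENNReal.toReal_mul]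
  exact congrArg ENNReal.toReal hmul

theorem ergodic_shift_infinitePi :
    Ergodic (shift (1 : ℤ)) (Measure.infinitePi fun _ : ℤ => p) where
  toMeasurePreserving := measurePreserving_shift_infinitePi p
  aeconst_set := by
    intro E hE hinv
    set m := Measure.infinitePi fun _ : ℤ => p with hm
    -- For a cylinder set `B` close to `E`, `μ (B ∩ T⁻ⁿ B) = (μ B) ^ 2`, and both sides are
    -- compared with the corresponding quantities for `E`.
    have hsmall : ∀ ε > 0, |m.real E - m.real E ^ 2| ≤ 4 * ε := by
      intro ε hε
      obtain ⟨s, S, hS, hlt⟩ := exists_cylinder_measureReal_symmDiff_lt p hE hε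
      obtain ⟨n, hn⟩ := exists_measureReal_cylinder_inter_preimage p s hS
      set B : Set (ℤ → A) := MeasureTheory.cylinder s S with hB
      have hBm : MeasurableSet B := hS.cylinder
      have hmp := (measurePreserving_shift_infinitePi p).iterate n
      have hEn : (shift (1 : ℤ))^[n] ⁻¹' E = E := by
        rw [Set.preimage_iterate_eq]
        exact Function.iterate_fixed hinv n
      have h1 : m.real (((shift (1 : ℤ))^[n] ⁻¹' B) ∆ E) < ε := by
        have h := hmp.measureReal_preimage (s := B ∆ E) (hBm.symmDiff hE).nullMeasurableSet
        rw [Set.preimage_symmDiff, hEn] at h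
        exact h.trans_lt hlt
      have h2 : |m.real (B ∩ (shift (1 : ℤ))^[n] ⁻¹' B) - m.real E| ≤ 2 * ε := by
        refine (abs_measureReal_sub_le_measureReal_symmDiff
          (hBm.inter (hmp.measurable hBm)).nullMeasurableSet hE.nullMeasurableSet).trans ?_
        have hsub : (B ∩ (shift (1 : ℤ))^[n] ⁻¹' B) ∆ E ⊆
            B ∆ E ∪ ((shift (1 : ℤ))^[n] ⁻¹' B) ∆ E := by
          intro x
          simp only [Set.mem_symmDiff, Set.mem_inter_iff, Set.mem_union]
          tauto
        refine (measureReal_mono hsub).trans ((measureReal_union_le _ _).trans ?_)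
        linarith
      have h3 : |m.real B - m.real E| ≤ ε :=
        (abs_measureReal_sub_le_measureReal_symmDiff hBm.nullMeasurableSet
          hE.nullMeasurableSet).trans hlt.le
      have hB1 : m.real B ≤ 1 := measureReal_le_one
      have hE1 : m.real E ≤ 1 := measureReal_le_one
      have hB0 : 0 ≤ m.real B := measureReal_nonneg
      have hE0 : 0 ≤ m.real E := measureReal_nonneg
      rw [hn] at h2
      have h4 : |m.real B ^ 2 - m.real E ^ 2| ≤ 2 * ε := by
        rw [sq_sub_sq, abs_mul, abs_of_nonneg (add_nonneg hB0 hE0)]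
        exact mul_le_mul (by linarith) h3 (abs_nonneg _) (by norm_num)
      rw [abs_le] at *
      constructor <;> linarith [h2.1, h2.2, h4.1, h4.2]
    have hzero : m.real E - m.real E ^ 2 = 0 := by
      rw [← abs_nonpos_iff]
      refine le_of_forall_pos_le_add fun ε hε => ?_
      linarith [hsmall (ε / 4) (by positivity)]
    have hfac : m.real E * (1 - m.real E) = 0 := by linarith
    rw [eventuallyConst_set']
    rcases mul_eq_zero.mp hfac with h | h
    · exact Or.inl (ae_eq_empty.mpr ((measureReal_eq_zero_iff).mp h))
    · refine Or.inr (ae_eq_univ.mpr ?_)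
      rw [← measureReal_eq_zero_iff, probReal_compl_eq_one_sub hE]
      exact h

end BernoulliShift

/-! ### The Bernoulli measures on the subshift -/

section Bernoulli

variable {ν : ℕ} {C : Set (Fin (2 * ν + 1))}

/-- The uniform Bernoulli measure on the full shift with symbols in `C`. -/
noncomputable abbrev fullBernoulli (ν : ℕ) (C : Set (Fin (2 * ν + 1))) :
    Measure (ℤ → Fin (2 * ν + 1)) :=
  Measure.infinitePi fun _ : ℤ => ProbabilityTheory.uniformOn C

theorem nonempty_of_colour (hν : 2 ≤ ν) (hC : C = green ν ∨ C = yellow ν) : C.Nonempty := by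
  rw [← Set.ncard_pos, ncard_of_colour hC]
  omega

theorem isProbabilityMeasure_uniformOn_colour (hν : 2 ≤ ν) (hC : C = green ν ∨ C = yellow ν) :
    IsProbabilityMeasure (ProbabilityTheory.uniformOn C) :=
  ProbabilityTheory.isProbabilityMeasure_uniformOn C.toFinite (nonempty_of_colour hν hC)

theorem ae_fullBernoulli_mem (hν : 2 ≤ ν) (hC : C = green ν ∨ C = yellow ν) :
    ∀ᵐ x ∂fullBernoulli ν C, ∀ i, x i ∈ C := by
  have := isProbabilityMeasure_uniformOn_colour hν hC
  rw [ae_all_iff]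
  intro i
  have h1 : ∀ᵐ a ∂ProbabilityTheory.uniformOn C, a ∈ C := by
    rw [ae_iff]
    refine (ProbabilityTheory.uniformOn_eq_zero_iff C.toFinite).mpr ?_
    ext a
    simp
  exact (measurePreserving_eval_infinitePi (fun _ : ℤ => ProbabilityTheory.uniformOn C)
    i).quasiMeasurePreserving.ae h1

variable (τ : ℝ)

theorem measurableEmbedding_val :
    MeasurableEmbedding (Subtype.val : (twoColourSubshift ν τ).carrier → ℤ → Fin (2 * ν + 1)) :=
  MeasurableEmbedding.subtype_coe (twoColourSubshift ν τ).isClosed.measurableSet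

theorem measurePreserving_val_bernoulliOn (hν : 2 ≤ ν) (hC : C = green ν ∨ C = yellow ν) :
    MeasurePreserving (Subtype.val : (twoColourSubshift ν τ).carrier → ℤ → Fin (2 * ν + 1))
      (bernoulliOn ν τ C) (fullBernoulli ν C) where
  measurable := measurable_subtype_coe
  map_eq := by
    rw [bernoulliOn, (measurableEmbedding_val τ).map_comap, Subtype.range_coe_subtype]
    refine Measure.restrict_eq_self_of_ae_mem ?_
    filter_upwards [ae_fullBernoulli_mem hν hC] with x hx
    exact isAdmissible_of_forall_mem hC hx

theorem isProbabilityMeasure_bernoulliOn (hν : 2 ≤ ν) (hC : C = green ν ∨ C = yellow ν) :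
    IsProbabilityMeasure (bernoulliOn ν τ C) := by
  have := isProbabilityMeasure_uniformOn_colour hν hC
  constructor
  rw [← Set.preimage_univ, (measurePreserving_val_bernoulliOn τ hν hC).measure_preimage_emb
    (measurableEmbedding_val τ)]
  exact measure_univ

theorem measurable_twoColourShift : Measurable (twoColourShift ν τ) :=
  Measurable.subtype_mk (f := fun x : (twoColourSubshift ν τ).carrier => shift (1 : ℤ) x.1)
    (measurable_pi_lambda _ fun _ => (measurable_pi_apply _).comp measurable_subtype_coe)

theorem ergodic_twoColourShift_bernoulliOn (hν : 2 ≤ ν) (hC : C = green ν ∨ C = yellow ν) :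
    Ergodic (twoColourShift ν τ) (bernoulliOn ν τ C) := by
  have := isProbabilityMeasure_uniformOn_colour hν hC
  have hval := measurePreserving_val_bernoulliOn τ hν hC
  have hemb := measurableEmbedding_val (ν := ν) τ
  have herg := ergodic_shift_infinitePi (ProbabilityTheory.uniformOn C)
  refine ⟨⟨measurable_twoColourShift τ, ?_⟩, ⟨fun E hE hinv => ?_⟩⟩
  · ext E hE
    have hF : MeasurableSet (Subtype.val '' E) := hemb.measurableSet_image.mpr hE
    rw [Measure.map_apply (measurable_twoColourShift τ) hE,
      ← Set.preimage_image_eq E Subtype.val_injective, hval.measure_preimage_emb hemb,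
      ← herg.measure_preimage hF.nullMeasurableSet, ← hval.measure_preimage_emb hemb]
    rfl
  · have hF : MeasurableSet (Subtype.val '' E) := hemb.measurableSet_image.mpr hE
    -- An invariant set of the subshift is invariant in the full shift, as the subshift is also
    -- mapped into itself by the inverse shift.
    have hFinv : shift (1 : ℤ) ⁻¹' (Subtype.val '' E) = Subtype.val '' E := by
      ext x
      constructor
      · rintro ⟨y, hy, hyx⟩
        have hx : x ∈ (twoColourSubshift ν τ).carrier := by
          have h := (twoColourSubshift ν τ).mapsTo (-1) y.2
          rw [hyx] at h
          convert h using 1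
          funext i
          simp
        refine ⟨⟨x, hx⟩, ?_, rfl⟩
        rw [← hinv]
        have : twoColourShift ν τ ⟨x, hx⟩ = y := Subtype.ext hyx.symm
        rwa [Set.mem_preimage, this]
      · rintro ⟨y, hy, rfl⟩
        rw [← hinv] at hy
        exact ⟨_, hy, rfl⟩
    have hconst := herg.aeconst_set hF hFinv
    have h := hconst.comp_tendsto hval.quasiMeasurePreserving.tendsto_ae
    rw [← Set.preimage_image_eq E Subtype.val_injective]
    exact h

theorem bernoulliOn_mutuallySingular (hν : 2 ≤ ν) :
    bernoulliOn ν τ (green ν) ⟂ₘ bernoulliOn ν τ (yellow ν) := by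
  have hae : ∀ C : Set (Fin (2 * ν + 1)), C = green ν ∨ C = yellow ν →
      ∀ᵐ x ∂bernoulliOn ν τ C, x.1 0 ∈ C := fun C hC => by
    filter_upwards [(measurePreserving_val_bernoulliOn τ hν hC).quasiMeasurePreserving.ae
      (ae_fullBernoulli_mem hν hC)] with x hx using hx 0
  have hdisj : Disjoint (yellow ν) (green ν) :=
    IsColourPair.disjoint (Or.inr ⟨rfl, rfl⟩)
  have hmeas : Measurable fun x : (twoColourSubshift ν τ).carrier => x.1 0 :=
    (measurable_pi_apply 0).comp measurable_subtype_coe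
  refine ⟨(fun x => x.1 0) ⁻¹' yellow ν, hmeas (Set.toFinite _).measurableSet, ?_, ?_⟩
  · refine measure_mono_null (fun x hx => ?_) (ae_iff.mp (hae _ (Or.inl rfl)))
    exact Set.disjoint_left.mp hdisj hx
  · exact ae_iff.mp (hae _ (Or.inr rfl))

end Bernoulli

/-! ### Entropy of finite partitions -/

section PartitionEntropy

variable {X : Type*} [MeasurableSpace X] {μ : Measure X} [IsProbabilityMeasure μ]

/-- Gibbs' inequality: the entropy of a partition is at most the mean code length `-log q` of any
subprobability vector `q`. -/
theorem partitionEntropy_le_integral {ι : Type*} [Fintype ι] [MeasurableSpace ι]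
    [MeasurableSingletonClass ι] {P : X → ι} (hP : Measurable P) {q : ι → ℝ} (hq : ∀ a, 0 < q a)
    (hq1 : ∑ a, q a ≤ 1) : partitionEntropy μ P ≤ ∫ x, -Real.log (q (P x)) ∂μ := by
  have hint : ∫ x, -Real.log (q (P x)) ∂μ = ∑ a, μ.real (P ⁻¹' {a}) * -Real.log (q a) := by
    have hprob : IsProbabilityMeasure (μ.map P) := Measure.isProbabilityMeasure_map hP.aemeasurable
    rw [← integral_map (φ := P) (f := fun a => -Real.log (q a)) hP.aemeasurable
      (measurable_of_finite _).aestronglyMeasurable, integral_fintype Integrable.of_finite]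
    refine Finset.sum_congr rfl fun a _ => ?_
    rw [map_measureReal_apply hP (measurableSet_singleton a), smul_eq_mul]
  have hsum : ∑ a, μ.real (P ⁻¹' {a}) = 1 := by
    rw [sum_measureReal_preimage_singleton Finset.univ
      fun a _ => hP (measurableSet_singleton a)]
    simp
  have hterm : ∀ a, Real.negMulLog (μ.real (P ⁻¹' {a})) ≤
      μ.real (P ⁻¹' {a}) * -Real.log (q a) + (q a - μ.real (P ⁻¹' {a})) := by
    intro a
    rcases (measureReal_nonneg (μ := μ) (s := P ⁻¹' {a})).eq_or_lt with h | h
    · rw [← h]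
      simpa using (hq a).le
    · have h1 := Real.log_le_sub_one_of_pos (div_pos (hq a) h)
      rw [Real.log_div (hq a).ne' h.ne'] at h1
      have h2 := mul_le_mul_of_nonneg_left h1 h.le
      rw [mul_sub, mul_sub, mul_div_cancel₀ _ h.ne'] at h2
      rw [Real.negMulLog]
      linarith
  rw [hint, partitionEntropy]
  refine (Finset.sum_le_sum fun a _ => hterm a).trans ?_
  rw [Finset.sum_add_distrib, Finset.sum_sub_distrib, hsum]
  linarith

variable {T : X → X}

/-- If `P` agrees with `P'` outside a set of measure at most `δ` and the `n`-itineraries of `P'`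
almost surely belong to `W`, then the `n`-itineraries of `P` are described by an element of `W`
together with corrections. The probability vector to which Gibbs' inequality is applied is that of
a uniform choice in `W` followed by independent corrections of the letters. -/
theorem partitionEntropy_refinedPartition_le (hT : MeasurePreserving T μ μ) {k n : ℕ} (hk : 0 < k)
    {P P' : X → Fin k} (hP : Measurable P) {D : Set X} (hD : MeasurableSet D)
    (hPP' : ∀ x ∉ D, P x = P' x) {δ : ℝ} (hδ0 : 0 < δ) (hδ1 : δ < 1) (hDδ : μ.real D ≤ δ)
    {W : Finset (Fin n → Fin k)} (hW : ∀ᵐ x ∂μ, refinedPartition T P' n x ∈ W) :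
    partitionEntropy μ (refinedPartition T P n) ≤
      Real.log W.card + n * (-Real.log (1 - δ) + δ * Real.log (k / δ)) := by
  have hkR : (0 : ℝ) < k := by exact_mod_cast hk
  have hk1 : (1 : ℝ) ≤ k := by exact_mod_cast hk
  have hWne : W.Nonempty := by
    obtain ⟨x, hx⟩ := hW.exists
    exact ⟨_, hx⟩
  have hWpos : (0 : ℝ) < W.card := by exact_mod_cast hWne.card_pos
  -- The law of the correction of a single letter `b`: it is kept with probability at least `1 - δ`.
  set r : Fin k → Fin k → ℝ := fun a b => (if a = b then 1 - δ else 0) + δ / k with hr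
  have hδk : 0 < δ / k := div_pos hδ0 hkR
  have hrpos : ∀ a b, 0 < r a b := fun a b => by
    have : (0 : ℝ) ≤ if a = b then 1 - δ else 0 := by split_ifs <;> linarith
    simp only [hr]
    linarith
  have hrsum : ∀ b, ∑ a, r a b = 1 := fun b => by
    simp only [hr]
    rw [Finset.sum_add_distrib, Finset.sum_ite_eq' Finset.univ b, Finset.sum_const,
      Finset.card_univ, Fintype.card_fin, nsmul_eq_mul]
    simp only [Finset.mem_univ, if_true]
    field_simp
    ring
  have hlogk : 0 ≤ Real.log (k / δ) := Real.log_nonneg (by rw [le_div_iff₀ hδ0]; linarith)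
  have hlogδ : 0 ≤ -Real.log (1 - δ) :=
    neg_nonneg.mpr (Real.log_nonpos (by linarith) (by linarith))
  set q : (Fin n → Fin k) → ℝ := fun a => (W.card : ℝ)⁻¹ * ∑ w ∈ W, ∏ j, r (a j) (w j) with hq
  have hqpos : ∀ a, 0 < q a := fun a => mul_pos (inv_pos.mpr hWpos)
    (Finset.sum_pos (fun w _ => Finset.prod_pos fun j _ => hrpos _ _) hWne)
  have hqsum : ∑ a, q a ≤ 1 := by
    have h : ∀ w : Fin n → Fin k, ∑ a : Fin n → Fin k, ∏ j, r (a j) (w j) = 1 := fun w => by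
      have h' := Finset.prod_univ_sum (fun _ => Finset.univ) fun (j : Fin n) a => r a (w j)
      rw [Fintype.piFinset_univ] at h'
      simp [← h', hrsum]
    simp only [hq]
    rw [← Finset.mul_sum, Finset.sum_comm, Finset.sum_congr rfl fun w _ => h w]
    simp [hWpos.ne']
  have hmeas : Measurable (refinedPartition T P n) :=
    measurable_pi_lambda _ fun j => hP.comp (hT.measurable.iterate j)
  -- An upper bound for the code length `-log q` of the itinerary.
  set f : X → ℝ := fun x => Real.log W.card + ∑ j : Fin n,
    (-Real.log (1 - δ) + (T^[j] ⁻¹' D).indicator (fun _ => Real.log (k / δ)) x) with hf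
  have hDj : ∀ j : ℕ, MeasurableSet (T^[j] ⁻¹' D) := fun j => hT.measurable.iterate j hD
  have hfj : ∀ j : Fin n, Integrable (fun x => -Real.log (1 - δ) +
      (T^[j] ⁻¹' D).indicator (fun _ => Real.log (k / δ)) x) μ := fun j =>
    (integrable_const _).add ((integrable_const _).indicator (hDj j))
  have hfint : Integrable f μ :=
    (integrable_const _).add (integrable_finsetSum _ fun j _ => hfj j)
  have hle : ∀ᵐ x ∂μ, -Real.log (q (refinedPartition T P n x)) ≤ f x := by
    filter_upwards [hW] with x hx
    set a := refinedPartition T P n x with ha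
    set w := refinedPartition T P' n x with hw
    have h1 : (W.card : ℝ)⁻¹ * ∏ j, r (a j) (w j) ≤ q a :=
      mul_le_mul_of_nonneg_left
        (Finset.single_le_sum (f := fun w => ∏ j, r (a j) (w j))
          (fun w _ => Finset.prod_nonneg fun j _ => (hrpos _ _).le) hx)
        (inv_nonneg.mpr hWpos.le)
    have hprod : 0 < ∏ j, r (a j) (w j) := Finset.prod_pos fun j _ => hrpos _ _
    have h2 := Real.log_le_log (mul_pos (inv_pos.mpr hWpos) hprod) h1
    rw [Real.log_mul (inv_ne_zero hWpos.ne') hprod.ne', Real.log_inv,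
      Real.log_prod fun j _ => (hrpos _ _).ne'] at h2
    have h3 : ∀ j : Fin n, -Real.log (r (a j) (w j)) ≤
        -Real.log (1 - δ) + (T^[j] ⁻¹' D).indicator (fun _ => Real.log (k / δ)) x := by
      intro j
      by_cases hxD : T^[j] x ∈ D
      · rw [Set.indicator_of_mem (show x ∈ T^[j] ⁻¹' D from hxD)]
        have h4 : δ / k ≤ r (a j) (w j) := by
          have : (0 : ℝ) ≤ if a j = w j then 1 - δ else 0 := by split_ifs <;> linarith
          simp only [hr]
          linarith
        have h5 := Real.log_le_log hδk h4
        rw [← inv_div, Real.log_inv] at h5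
        linarith
      · rw [Set.indicator_of_notMem (show x ∉ T^[j] ⁻¹' D from hxD), add_zero]
        have h4 : a j = w j := hPP' _ hxD
        refine neg_le_neg (Real.log_le_log (by linarith) ?_)
        simp only [hr, h4, if_true]
        linarith
    have h6 := Finset.sum_le_sum fun j (_ : j ∈ Finset.univ) => h3 j
    rw [Finset.sum_neg_distrib] at h6
    simp only [hf]
    linarith
  have hval : ∫ x, f x ∂μ ≤ Real.log W.card + n * (-Real.log (1 - δ) + δ * Real.log (k / δ)) := by
    have h1 : ∀ j : Fin n, ∫ x, (-Real.log (1 - δ) +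
        (T^[j] ⁻¹' D).indicator (fun _ => Real.log (k / δ)) x) ∂μ ≤
        -Real.log (1 - δ) + δ * Real.log (k / δ) := by
      intro j
      rw [integral_add (integrable_const _) ((integrable_const _).indicator (hDj j)),
        integral_const, integral_indicator_const _ (hDj j),
        (hT.iterate j).measureReal_preimage hD.nullMeasurableSet]
      simp only [probReal_univ, smul_eq_mul, one_mul]
      gcongr
    simp only [hf]
    rw [integral_add (integrable_const _) (integrable_finsetSum _ fun j _ => hfj j),
      integral_const, integral_finsetSum _ fun j _ => hfj j]
    simp only [probReal_univ, smul_eq_mul, one_mul]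
    gcongr
    refine (Finset.sum_le_sum fun j _ => h1 j).trans (le_of_eq ?_)
    rw [Finset.sum_const, Finset.card_univ, Fintype.card_fin, nsmul_eq_mul]
  have hbd : Integrable (fun x => -Real.log (q (refinedPartition T P n x))) μ := by
    have : IsFiniteMeasure (μ.map (refinedPartition T P n)) := inferInstance
    exact (Integrable.of_finite (μ := μ.map (refinedPartition T P n))
      (f := fun a => -Real.log (q a))).comp_measurable hmeas
  exact (partitionEntropy_le_integral hmeas hqpos hqsum).trans
    ((integral_mono_ae hbd hfint hle).trans hval)

end PartitionEntropy

/-- The correction cost per letter is negligible when the partitions almost agree. -/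
theorem tendsto_correction_cost {k : ℕ} (hk : 0 < k) :
    Tendsto (fun δ : ℝ => -Real.log (1 - δ) + δ * Real.log (k / δ)) (𝓝[>] 0) (𝓝 0) := by
  have h1 : Tendsto (fun δ : ℝ => -Real.log (1 - δ) + (δ * Real.log k + Real.negMulLog δ)) (𝓝 0)
      (𝓝 (-Real.log (1 - 0) + (0 * Real.log k + Real.negMulLog 0))) := by
    refine Tendsto.add (Tendsto.neg ?_) (Tendsto.add (tendsto_id.mul_const _)
      (Real.continuous_negMulLog.tendsto 0))
    exact ((Real.continuousAt_log (by norm_num)).tendsto).comp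
      (tendsto_const_nhds.sub tendsto_id)
  simp only [sub_zero, Real.log_one, neg_zero, zero_mul, Real.negMulLog_zero, add_zero] at h1
  refine (h1.mono_left nhdsWithin_le_nhds).congr' ?_
  filter_upwards [self_mem_nhdsWithin] with δ hδ
  rw [Real.log_div (by positivity) (ne_of_gt hδ), Real.negMulLog]
  ring

/-! ### Metric entropy of the Bernoulli measures -/

section Bernoulli

open scoped symmDiff

variable {ν : ℕ} {C : Set (Fin (2 * ν + 1))}

/-- A measurable partition of the subshift agrees, up to a set of small measure, with a partition
that depends on finitely many coordinates only. -/
theorem exists_local_approximation (hν : 2 ≤ ν) (τ : ℝ) (hC : C = green ν ∨ C = yellow ν) {k : ℕ}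
    (hk : 0 < k) {P : (twoColourSubshift ν τ).carrier → Fin k} (hP : Measurable P) {δ : ℝ}
    (hδ : 0 < δ) : ∃ (m : ℕ) (G : (ℤ → Fin (2 * ν + 1)) → Fin k)
      (D : Set (twoColourSubshift ν τ).carrier),
      (∀ x y, (∀ i : ℤ, -(m : ℤ) ≤ i → i ≤ m → x i = y i) → G x = G y) ∧
      MeasurableSet D ∧ (bernoulliOn ν τ C).real D ≤ δ ∧ ∀ x ∉ D, P x = G x.1 := by
  classical
  have := isProbabilityMeasure_uniformOn_colour hν hC
  have hprob := isProbabilityMeasure_bernoulliOn τ hν hC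
  have hval := measurePreserving_val_bernoulliOn τ hν hC
  have hkR : (0 : ℝ) < k := by exact_mod_cast hk
  have : Nonempty (Fin k) := ⟨⟨0, hk⟩⟩
  have hE : ∀ a, MeasurableSet (Subtype.val '' (P ⁻¹' {a})) := fun a =>
    (measurableEmbedding_val τ).measurableSet_image.mpr (hP (measurableSet_singleton a))
  choose s S hS hlt using fun a => exists_cylinder_measureReal_symmDiff_lt
    (ProbabilityTheory.uniformOn C) (hE a) (div_pos hδ hkR)
  set B : Fin k → Set (ℤ → Fin (2 * ν + 1)) := fun a => MeasureTheory.cylinder (s a) (S a) with hB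
  have hBm : ∀ a, MeasurableSet (B a) := fun a => (hS a).cylinder
  -- Off the exceptional set exactly one of the `B a` contains the point.
  set G : (ℤ → Fin (2 * ν + 1)) → Fin k := fun x => Classical.epsilon fun a => x ∈ B a with hG
  refine ⟨(Finset.univ.biUnion s).sup Int.natAbs, G,
    ⋃ a, Subtype.val ⁻¹' (B a ∆ (Subtype.val '' (P ⁻¹' {a}))), ?_, ?_, ?_, ?_⟩
  · intro x y hxy
    have h : ∀ a, x ∈ B a ↔ y ∈ B a := fun a => by
      simp only [hB, MeasureTheory.mem_cylinder]
      refine iff_of_eq (congrArg (· ∈ S a) (funext fun i => ?_))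
      have hi : (i : ℤ).natAbs ≤ (Finset.univ.biUnion s).sup Int.natAbs :=
        Finset.le_sup (Finset.mem_biUnion.mpr ⟨a, Finset.mem_univ a, i.2⟩)
      exact hxy i (by omega) (by omega)
    simp only [hG, h]
  · exact MeasurableSet.iUnion fun a => measurable_subtype_coe ((hBm a).symmDiff (hE a))
  · refine (measureReal_iUnion_fintype_le _).trans ?_
    have h : ∀ a, (bernoulliOn ν τ C).real
        (Subtype.val ⁻¹' (B a ∆ (Subtype.val '' (P ⁻¹' {a})))) ≤ δ / k := fun a => by
      rw [hval.measureReal_preimage ((hBm a).symmDiff (hE a)).nullMeasurableSet]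
      exact (hlt a).le
    refine (Finset.sum_le_sum fun a _ => h a).trans (le_of_eq ?_)
    simp
    field_simp
  · intro x hx
    simp only [Set.mem_iUnion, not_exists, Set.mem_preimage, Set.mem_symmDiff, not_or, not_and,
      not_not, Subtype.val_injective.mem_set_image, Set.mem_singleton_iff] at hx
    have h1 : x.1 ∈ B (P x) := (hx (P x)).2 rfl
    have h2 : x.1 ∈ B (G x.1) := Classical.epsilon_spec (p := fun a => x.1 ∈ B a) ⟨_, h1⟩
    exact (hx _).1 h2

theorem metricEntropy_bernoulliOn_le (hν : 2 ≤ ν) (τ : ℝ) (hC : C = green ν ∨ C = yellow ν) :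
    metricEntropy (twoColourShift ν τ) (bernoulliOn ν τ C) ≤ (Real.log ν : EReal) := by
  have hprob := isProbabilityMeasure_bernoulliOn τ hν hC
  have hval := measurePreserving_val_bernoulliOn τ hν hC
  have hmp := (ergodic_twoColourShift_bernoulliOn τ hν hC).toMeasurePreserving
  have hνR : (2 : ℝ) ≤ ν := by exact_mod_cast hν
  have hlogν : 0 ≤ Real.log ν := Real.log_nonneg (by linarith)
  refine iSup_le fun k => iSup₂_le fun P hP => ?_
  have hk : 0 < k := by
    obtain ⟨x⟩ := nonempty_of_isProbabilityMeasure (bernoulliOn ν τ C)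
    exact (Nat.zero_le _).trans_lt (P x).2
  have key : ∀ δ : ℝ, 0 < δ → δ < 1 →
      metricEntropyOfPartition (twoColourShift ν τ) (bernoulliOn ν τ C) P ≤
        ((Real.log ν + (-Real.log (1 - δ) + δ * Real.log (k / δ)) : ℝ) : EReal) := by
    intro δ hδ0 hδ1
    obtain ⟨m, G, D, hG, hD, hDδ, hPG⟩ := exists_local_approximation hν τ hC hk hP hδ0
    set c := -Real.log (1 - δ) + δ * Real.log (k / δ) with hc
    have hbound : ∀ n : ℕ, partitionEntropy (bernoulliOn ν τ C)
        (refinedPartition (twoColourShift ν τ) P n) ≤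
        ((n + (2 * m + 1) : ℕ) : ℝ) * Real.log ν + n * c := by
      intro n
      -- The itineraries of the local partition `G` along monochromatic sequences.
      set V : Set (Fin n → Fin k) := (fun (x : ℤ → Fin (2 * ν + 1)) (j : Fin n) =>
        G ((shift (1 : ℤ))^[j] x)) '' {x | ∀ i, x i ∈ C} with hV
      have hVfin : V.Finite := Set.toFinite _
      have hVcard : V.ncard ≤ ν ^ (n + (2 * m + 1)) := by
        have h1 : V.ncard ≤ wordCount {x | ∀ i, x i ∈ C} (-(m : ℤ)) (n + (2 * m + 1)) := by
          refine Set.ncard_image_le_ncard_image (Set.toFinite _) fun x _ y _ hxy => ?_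
          funext j
          refine hG _ _ fun i hi hi' => ?_
          rw [shift_iterate_apply, shift_iterate_apply]
          have hj := j.2
          have h := congrFun hxy ⟨(j + i + m).toNat, by omega⟩
          have e : -(m : ℤ) + ((j + i + m).toNat : ℤ) = j + i := by omega
          simp only [e] at h
          exact h
        refine h1.trans ?_
        have h2 := wordCount_le_pow (S := {x | ∀ i, x i ∈ C}) (C := C) (i := -(m : ℤ))
          (n := n + (2 * m + 1)) fun x hx k _ => hx _
        rwa [ncard_of_colour hC] at h2
      have hW : ∀ᵐ x ∂bernoulliOn ν τ C,
          refinedPartition (twoColourShift ν τ) (fun x => G x.1) n x ∈ hVfin.toFinset := by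
        filter_upwards [hval.quasiMeasurePreserving.ae (ae_fullBernoulli_mem hν hC)] with x hx
        rw [Set.Finite.mem_toFinset]
        refine ⟨x.1, hx, ?_⟩
        funext j
        refine congrArg G (funext fun i => ?_)
        rw [shift_iterate_apply, twoColourShift_iterate_apply]
      have h := partitionEntropy_refinedPartition_le hmp hk hP hD hPG hδ0 hδ1 hDδ hW
      refine h.trans ?_
      have hpos : 0 < hVfin.toFinset.card := by
        obtain ⟨x, hx⟩ := hW.exists
        exact Finset.card_pos.mpr ⟨_, hx⟩
      rw [← Set.ncard_eq_toFinset_card V hVfin] at hpos ⊢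
      have h3 : Real.log V.ncard ≤ ((n + (2 * m + 1) : ℕ) : ℝ) * Real.log ν := by
        rw [← Real.log_pow]
        exact Real.log_le_log (by exact_mod_cast hpos) (by exact_mod_cast hVcard)
      linarith
    have hlim : Tendsto (fun n : ℕ => ((2 * m + 1 : ℕ) * Real.log ν) / n + (Real.log ν + c)) atTop
        (𝓝 (0 + (Real.log ν + c))) :=
      (tendsto_const_div_atTop_nhds_zero_nat _).add tendsto_const_nhds
    rw [zero_add] at hlim
    have hlim' := (continuous_coe_real_ereal.tendsto _).comp hlim
    rw [metricEntropyOfPartition, ← hlim'.limsup_eq]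
    refine limsup_le_limsup ?_
    filter_upwards [eventually_gt_atTop 0] with n hn
    have hnR : (0 : ℝ) < n := by exact_mod_cast hn
    simp only [Function.comp]
    rw [EReal.coe_le_coe_iff, div_le_iff₀ hnR]
    refine (hbound n).trans (le_of_eq ?_)
    push_cast
    field_simp
    ring
  have hlim := (continuous_coe_real_ereal.tendsto _).comp
    ((tendsto_correction_cost hk).const_add (Real.log ν))
  rw [add_zero] at hlim
  refine ge_of_tendsto hlim ?_
  filter_upwards [Ioo_mem_nhdsGT (zero_lt_one' ℝ)] with δ hδ
  exact key δ hδ.1 hδ.2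

theorem uniformOn_real_singleton (hC : C = green ν ∨ C = yellow ν) (a : Fin (2 * ν + 1))
    [Decidable (a ∈ C)] :
    (ProbabilityTheory.uniformOn C).real {a} = if a ∈ C then (ν : ℝ)⁻¹ else 0 := by
  rw [measureReal_def, ProbabilityTheory.uniformOn,
    ProbabilityTheory.cond_apply (Set.toFinite C).measurableSet,
    Measure.count_apply_finite C C.toFinite, ← Set.ncard_eq_toFinset_card C C.toFinite,
    ncard_of_colour hC]
  split_ifs with h
  · rw [Set.inter_eq_right.mpr (Set.singleton_subset_iff.mpr h), Measure.count_singleton]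
    simp
  · rw [Set.inter_singleton_eq_empty.mpr h]
    simp

theorem bernoulliOn_real_itinerary (hν : 2 ≤ ν) (τ : ℝ) (hC : C = green ν ∨ C = yellow ν) (n : ℕ)
    (a : Fin n → Fin (2 * ν + 1)) :
    (bernoulliOn ν τ C).real
      (refinedPartition (twoColourShift ν τ) (fun x => x.1 0) n ⁻¹' {a}) =
      ∏ j, (ProbabilityTheory.uniformOn C).real {a j} := by
  have := isProbabilityMeasure_uniformOn_colour hν hC
  have hval := measurePreserving_val_bernoulliOn τ hν hC
  -- The fibre is a cylinder over `0, …, n - 1`; the junk value of `Int.toNat` at negative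
  -- coordinates is harmless, as these are not in `s`.
  set s : Finset ℤ := (Finset.range n).map Nat.castEmbedding with hs
  set t : ℤ → Set (Fin (2 * ν + 1)) := fun i => {b | ∀ h : i.toNat < n, b = a ⟨i.toNat, h⟩} with ht
  have e : refinedPartition (twoColourShift ν τ) (fun x => x.1 0) n ⁻¹' {a} =
      Subtype.val ⁻¹' (Set.pi s t) := by
    ext x
    simp only [Set.mem_preimage, Set.mem_singleton_iff, Set.mem_pi, funext_iff, refinedPartition,
      twoColourShift_iterate_apply, add_zero, hs, ht, Finset.coe_map, Set.mem_image,
      Finset.mem_coe, Finset.mem_range, Set.mem_ofPred_eq]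
    constructor
    · rintro h _ ⟨j, hj, rfl⟩ h'
      exact h ⟨j, hj⟩
    · intro h j
      exact h j ⟨j, j.2, rfl⟩ (by simp)
  have hpi : MeasurableSet (Set.pi (s : Set ℤ) t) :=
    MeasurableSet.pi s.countable_toSet fun i _ => (Set.toFinite _).measurableSet
  rw [e, hval.measureReal_preimage hpi.nullMeasurableSet, measureReal_def,
    Measure.infinitePi_pi _ fun i _ => (Set.toFinite _).measurableSet, ENNReal.toReal_prod, hs,
    Finset.prod_map, Finset.prod_range]
  refine Finset.prod_congr rfl fun j _ => ?_
  rw [measureReal_def]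
  congr 2
  ext b
  simp [ht]

theorem le_metricEntropy_bernoulliOn (hν : 2 ≤ ν) (τ : ℝ) (hC : C = green ν ∨ C = yellow ν) :
    (Real.log ν : EReal) ≤ metricEntropy (twoColourShift ν τ) (bernoulliOn ν τ C) := by
  classical
  have hprob := isProbabilityMeasure_bernoulliOn τ hν hC
  set P : (twoColourSubshift ν τ).carrier → Fin (2 * ν + 1) := fun x => x.1 0 with hPdef
  have hP : Measurable P := (measurable_pi_apply 0).comp measurable_subtype_coe
  have hH : ∀ n : ℕ, partitionEntropy (bernoulliOn ν τ C)
      (refinedPartition (twoColourShift ν τ) P n) = n * Real.log ν := by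
    intro n
    -- The itineraries of positive measure all have measure `ν ^ (-n)`.
    have hterm : ∀ a : Fin n → Fin (2 * ν + 1),
        Real.negMulLog ((bernoulliOn ν τ C).real
          (refinedPartition (twoColourShift ν τ) P n ⁻¹' {a})) =
        (bernoulliOn ν τ C).real (refinedPartition (twoColourShift ν τ) P n ⁻¹' {a}) *
          (n * Real.log ν) := by
      intro a
      rw [bernoulliOn_real_itinerary hν τ hC]
      simp only [uniformOn_real_singleton hC]
      by_cases h : ∀ j, a j ∈ C
      · simp only [h, if_true, Finset.prod_const, Finset.card_univ, Fintype.card_fin]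
        rw [Real.negMulLog, Real.log_pow, Real.log_inv]
        ring
      · push Not at h
        obtain ⟨j, hj⟩ := h
        rw [Finset.prod_eq_zero (Finset.mem_univ j) (if_neg hj)]
        simp
    have hmeas : Measurable (refinedPartition (twoColourShift ν τ) P n) :=
      measurable_pi_lambda _ fun j => hP.comp ((measurable_twoColourShift τ).iterate j)
    rw [partitionEntropy, Finset.sum_congr rfl fun a _ => hterm a, ← Finset.sum_mul,
      sum_measureReal_preimage_singleton Finset.univ
        fun a _ => hmeas (measurableSet_singleton a)]
    simp
  have hPle : metricEntropyOfPartition (twoColourShift ν τ) (bernoulliOn ν τ C) P ≤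
      metricEntropy (twoColourShift ν τ) (bernoulliOn ν τ C) :=
    le_iSup_of_le (2 * ν + 1) (le_iSup₂_of_le P hP le_rfl)
  refine le_trans (le_of_eq ?_) hPle
  rw [metricEntropyOfPartition]
  refine (Tendsto.limsup_eq (tendsto_const_nhds.congr' ?_)).symm
  filter_upwards [eventually_gt_atTop 0] with n hn
  rw [hH n, mul_div_cancel_left₀ _ (by positivity)]

theorem isMeasureOfMaximalEntropy_bernoulliOn (hν : 2 ≤ ν) {τ : ℝ}
    (hτ : Real.log 3 / Real.log ν ≤ τ) (hC : C = green ν ∨ C = yellow ν) :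
    IsMeasureOfMaximalEntropy (twoColourShift ν τ) (bernoulliOn ν τ C) where
  isProbabilityMeasure := isProbabilityMeasure_bernoulliOn τ hν hC
  measurePreserving := (ergodic_twoColourShift_bernoulliOn τ hν hC).toMeasurePreserving
  metricEntropy_eq := by
    rw [coverEntropy_twoColourShift hν hτ]
    exact (metricEntropy_bernoulliOn_le hν τ hC).antisymm (le_metricEntropy_bernoulliOn hν τ hC)

end Bernoulli

/-! ### Gluing and topological mixing -/

section Mixing

variable {ν : ℕ} {τ : ℝ} {x y : ℤ → Fin (2 * ν + 1)}

theorem IsColourPair.ne_zero {C D : Set (Fin (2 * ν + 1))} (h : IsColourPair ν C D)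
    {s : Fin (2 * ν + 1)} (hs : s ∈ C) : s ≠ 0 :=
  fun h0 => zero_notMem_of_colour h.colour (h0 ▸ hs)

/-- A run of one colour cannot cross a zero. -/
theorem IsWordIn.lt_or_gt {C : Set (Fin (2 * ν + 1))} (hC : C = green ν ∨ C = yellow ν) {i : ℤ}
    {a : ℕ} (h : IsWordIn C x i a) {j : ℤ} (hj : x j = 0) : i + a ≤ j ∨ j < i := by
  by_contra! hcon
  have h1 := h (j - i).toNat (by omega)
  have e : i + ((j - i).toNat : ℤ) = j := by omega
  rw [e, hj] at h1
  exact zero_notMem_of_colour hC h1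

theorem isWordIn_congr {A : Type*} {C : Set A} {x y : ℤ → A} {i : ℤ} {n : ℕ}
    (h : ∀ j, i ≤ j → j < i + n → x j = y j) : IsWordIn C x i n ↔ IsWordIn C y i n := by
  refine forall₂_congr fun k hk => ?_
  rw [h _ (by omega) (by omega)]

/-- The sequence agreeing with `x` on the window `[p, q)` and zero elsewhere. -/
def truncate (x : ℤ → Fin (2 * ν + 1)) (p q : ℤ) : ℤ → Fin (2 * ν + 1) :=
  fun i => if p ≤ i ∧ i < q then x i else 0

/-- The sequence agreeing with `x` on `(-∞, p)` and with `y` on `[p, ∞)`. -/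
def glue (x y : ℤ → Fin (2 * ν + 1)) (p : ℤ) : ℤ → Fin (2 * ν + 1) :=
  fun i => if i < p then x i else y i

theorem isAdmissible_truncate (hx : IsAdmissible ν τ x) (p q : ℤ) :
    IsAdmissible ν τ (truncate x p q) := by
  have hin : ∀ i, truncate x p q i ≠ 0 → p ≤ i ∧ i < q := fun i h => by
    by_contra hcon
    exact h (if_neg hcon)
  have heq : ∀ i, p ≤ i → i < q → truncate x p q i = x i := fun i h h' => if_pos ⟨h, h'⟩
  constructor
  · intro C hC i l h₁ h₂ h₃
    obtain ⟨D, hCD⟩ := isColourPair_of_colour hC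
    have e₁ := hin _ (hCD.ne_zero h₁)
    have e₃ := hin _ (hCD.ne_zero h₃)
    refine hx.same_colour C hC i l ?_ ?_ ?_
    · rwa [heq _ e₁.1 e₁.2] at h₁
    · rwa [isWordIn_congr fun j _ _ => heq j (by omega) (by omega)] at h₂
    · rwa [heq _ e₃.1 e₃.2] at h₃
  · intro C D hCD i a l b ha hb h₁ h₂ h₃
    replace hCD : IsColourPair ν C D := hCD
    have e₁ := hin _ (hCD.ne_zero (h₁ 0 ha))
    have e₃ := hin _ (hCD.symm.ne_zero (h₃ (b - 1) (by omega)))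
    refine hx.change_colour C D hCD i a l b ha hb ?_ ?_ ?_
    · rwa [isWordIn_congr fun j _ _ => heq j (by omega) (by omega)] at h₁
    · rwa [isWordIn_congr fun j _ _ => heq j (by omega) (by omega)] at h₂
    · rwa [isWordIn_congr fun j _ _ => heq j (by omega) (by omega)] at h₃

/-- The last coloured symbol of `x` and the first coloured symbol of `y` have the same colour. -/
def ColourClash (x y : ℤ → Fin (2 * ν + 1)) : Prop :=
  ∃ C, (C = green ν ∨ C = yellow ν) ∧ ∃ i j, x i ∈ C ∧ (∀ k, i < k → x k = 0) ∧
    y j ∈ C ∧ ∀ k, k < j → y k = 0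

theorem not_colourClash {C D : Set (Fin (2 * ν + 1))} (hCD : IsColourPair ν C D) {i j : ℤ}
    (hi : x i ∈ C) (hi' : ∀ k, i < k → x k = 0) (hj : y j ∈ D) (hj' : ∀ k, k < j → y k = 0) :
    ¬ ColourClash x y := by
  rintro ⟨C', hC', i', j', h₁, h₁', h₂, h₂'⟩
  obtain ⟨D', hCD'⟩ := isColourPair_of_colour hC'
  have e₁ : i' = i := by
    by_contra hne
    rcases lt_or_gt_of_ne hne with h | h
    · exact hCD.ne_zero hi (h₁' i h)
    · exact hCD'.ne_zero h₁ (hi' i' h)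
  have e₂ : j' = j := by
    by_contra hne
    rcases lt_or_gt_of_ne hne with h | h
    · exact hCD'.ne_zero h₂ (hj' j' h)
    · exact hCD.symm.ne_zero hj (h₂' j h)
  subst e₁ e₂
  have hor : C' = C ∨ C' = D := by
    rcases hC' with rfl | rfl <;> rcases hCD with ⟨rfl, rfl⟩ | ⟨rfl, rfl⟩ <;> simp
  rcases hor with rfl | rfl
  · exact Set.disjoint_left.mp hCD.disjoint h₂ hj
  · exact Set.disjoint_left.mp hCD.disjoint hi h₁

/-- Two admissible sequences with bounded supports can be glued along a long string of zeros,
provided that the last colour of the first differs from the first colour of the second. -/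
theorem isAdmissible_glue (hx : IsAdmissible ν τ x) (hy : IsAdmissible ν τ y) {r p q s : ℤ}
    (hτ : 0 < τ) (hxs : ∀ i, x i ≠ 0 → r ≤ i ∧ i < p) (hys : ∀ i, y i ≠ 0 → q ≤ i ∧ i < s)
    (hpq : p < q) (hlong : τ * ((p - r : ℤ) + (s - q : ℤ)) ≤ ((q - p : ℤ) : ℝ))
    (hcol : ¬ ColourClash x y) :
    IsAdmissible ν τ (glue x y p) := by
  have hleft : ∀ i, i < q → glue x y p i = x i := fun i hi => by
    by_cases h : i < p
    · exact if_pos h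
    · have h1 : x i = 0 := by
        by_contra hcon
        exact h (hxs i hcon).2
      have h2 : y i = 0 := by
        by_contra hcon
        exact absurd (hys i hcon).1 (by omega)
      rw [h1, ← h2]
      exact if_neg h
  have hright : ∀ i, p ≤ i → glue x y p i = y i := fun i hi => if_neg (by omega)
  have hp : glue x y p p = 0 := by
    rw [hleft p hpq]
    by_contra hcon
    exact absurd (hxs p hcon).2 (lt_irrefl p)
  have hx0 : ∀ i, p ≤ i → x i = 0 := fun i hi => by
    by_contra hcon
    exact absurd (hxs i hcon).2 (by omega)
  have hy0 : ∀ i, i < q → y i = 0 := fun i hi => by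
    by_contra hcon
    exact absurd (hys i hcon).1 (by omega)
  constructor
  · intro C hC i l h₁ h₂ h₃
    obtain ⟨D, hCD⟩ := isColourPair_of_colour hC
    have n₁ := hCD.ne_zero h₁
    have n₃ := hCD.ne_zero h₃
    rcases lt_or_ge i p with hi | hi
    · rcases lt_or_ge (i + 1 + l) q with hl | hl
      · refine hx.same_colour C hC i l ?_ ?_ ?_
        · rwa [hleft _ (by omega)] at h₁
        · rwa [isWordIn_congr fun j _ _ => hleft j (by omega)] at h₂
        · rwa [hleft _ hl] at h₃
      · exfalso
        rw [hleft _ (by omega)] at h₁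
        rw [hright _ (by omega)] at h₃
        refine hcol ⟨C, hC, i, i + 1 + l, h₁, fun k hk => ?_, h₃, fun k hk => ?_⟩
        · rcases lt_or_ge k p with hkp | hkp
          · have h := h₂ (k - (i + 1)).toNat (by omega)
            have e : i + 1 + ((k - (i + 1)).toNat : ℤ) = k := by omega
            rwa [e, hleft _ (by omega)] at h
          · exact hx0 k hkp
        · rcases lt_or_ge k q with hkq | hkq
          · exact hy0 k hkq
          · have h := h₂ (k - (i + 1)).toNat (by omega)
            have e : i + 1 + ((k - (i + 1)).toNat : ℤ) = k := by omega
            rwa [e, hright _ (by omega)] at h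
    · refine hy.same_colour C hC i l ?_ ?_ ?_
      · rwa [hright _ hi] at h₁
      · rwa [isWordIn_congr fun j _ _ => hright j (by omega)] at h₂
      · rwa [hright _ (by omega)] at h₃
  · intro C D hCD i a l b ha hb h₁ h₂ h₃
    replace hCD : IsColourPair ν C D := hCD
    rcases h₁.lt_or_gt hCD.colour hp with hi | hi
    · rcases h₃.lt_or_gt hCD.symm.colour hp with hj | hj
      · refine hx.change_colour C D hCD i a l b ha hb ?_ ?_ ?_
        · rwa [isWordIn_congr fun j _ _ => hleft j (by omega)] at h₁
        · rwa [isWordIn_congr fun j _ _ => hleft j (by omega)] at h₂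
        · rwa [isWordIn_congr fun j _ _ => hleft j (by omega)] at h₃
      · -- The first word lies in the support of `x` and the second in that of `y`.
        rw [isWordIn_congr fun j _ _ => hleft j (by omega)] at h₁
        rw [isWordIn_congr fun j _ _ => hright j (by omega)] at h₃
        have e₁ := hxs _ (hCD.ne_zero (h₁ 0 ha))
        have e₂ := hxs _ (hCD.ne_zero (h₁ (a - 1) (by omega)))
        have e₃ := hys _ (hCD.symm.ne_zero (h₃ 0 hb))
        have e₄ := hys _ (hCD.symm.ne_zero (h₃ (b - 1) (by omega)))
        have ea : (a : ℝ) ≤ ((p - r : ℤ) : ℝ) := by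
          rw [← Int.cast_natCast, Int.cast_le]; omega
        have eb : (b : ℝ) ≤ ((s - q : ℤ) : ℝ) := by
          rw [← Int.cast_natCast, Int.cast_le]; omega
        have el : ((q - p : ℤ) : ℝ) ≤ (l : ℝ) := by
          rw [← Int.cast_natCast (R := ℝ) l, Int.cast_le]; omega
        exact (mul_le_mul_of_nonneg_left (add_le_add ea eb) hτ.le).trans (hlong.trans el)
    · refine hy.change_colour C D hCD i a l b ha hb ?_ ?_ ?_
      · rwa [isWordIn_congr fun j _ _ => hright j (by omega)] at h₁
      · rwa [isWordIn_congr fun j _ _ => hright j (by omega)] at h₂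
      · rwa [isWordIn_congr fun j _ _ => hright j (by omega)] at h₃

theorem exists_isAdmissible_of_not_colourClash (hτ : 0 < τ) (hx : IsAdmissible ν τ x)
    (hy : IsAdmissible ν τ y) {r p q s : ℤ} (hxs : ∀ i, x i ≠ 0 → r ≤ i ∧ i < p)
    (hys : ∀ i, y i ≠ 0 → q ≤ i ∧ i < s) (hcol : ¬ ColourClash x y) :
    ∃ N : ℕ, ∀ n : ℕ, N ≤ n → ∃ z, IsAdmissible ν τ z ∧ (∀ i < p, z i = x i) ∧
      ∀ i, q ≤ i → z (n + i) = y i := by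
  obtain ⟨M, hM⟩ := exists_nat_ge (τ * ((p - r : ℤ) + (s - q : ℤ)))
  refine ⟨M + (p - q).toNat + 1, fun n hn => ⟨glue x (shift (-n : ℤ) y) p, ?_, ?_, ?_⟩⟩
  · refine isAdmissible_glue hx (hy.shift _) (r := r) (q := n + q) (s := n + s) hτ hxs
      (fun i hi => ?_) (by omega) ?_ ?_
    · have := hys _ hi
      omega
    · have e : (n + s - (n + q) : ℤ) = s - q := by ring
      rw [e]
      refine hM.trans ?_
      rw [← Int.cast_natCast, Int.cast_le]
      omega
    · rintro ⟨C, hC, i, j, h₁, h₁', h₂, h₂'⟩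
      refine hcol ⟨C, hC, i, -n + j, h₁, h₁', h₂, fun k hk => ?_⟩
      have h := h₂' (n + k) (by omega)
      rw [shift_apply] at h
      rwa [neg_add_cancel_left] at h
  · exact fun i hi => if_pos hi
  · intro i hi
    have : ¬ ((n : ℤ) + i < p) := by omega
    rw [glue, if_neg this, shift_apply, neg_add_cancel_left]

/-- Any two admissible sequences with bounded supports occur in one admissible sequence at every
sufficiently large distance. If their colours clash, a single symbol of the other colour is inserted
at a fixed distance to the right of the first one. -/
theorem exists_isAdmissible_of_bounded (hν : 2 ≤ ν) (hτ : 0 < τ) (hx : IsAdmissible ν τ x)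
    (hy : IsAdmissible ν τ y) {r p q s : ℤ} (hxs : ∀ i, x i ≠ 0 → r ≤ i ∧ i < p)
    (hys : ∀ i, y i ≠ 0 → q ≤ i ∧ i < s) :
    ∃ N : ℕ, ∀ n : ℕ, N ≤ n → ∃ z, IsAdmissible ν τ z ∧ (∀ i < p, z i = x i) ∧
      ∀ i, q ≤ i → z (n + i) = y i := by
  by_cases hcol : ColourClash x y
  · obtain ⟨C, hC, i, j, h₁, h₁', h₂, h₂'⟩ := hcol
    obtain ⟨D, hCD⟩ := isColourPair_of_colour hC
    obtain ⟨d, hd⟩ := nonempty_of_colour hν hCD.symm.colour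
    have hip := hxs i (hCD.ne_zero h₁)
    set u : ℤ → Fin (2 * ν + 1) := fun _ => d with hu
    have hu' : IsAdmissible ν τ u := isAdmissible_of_forall_mem hCD.symm.colour fun _ => hd
    obtain ⟨M, hM⟩ := exists_nat_ge (τ * ((p - r : ℤ) + 1))
    set c : ℤ := p + M + 1 with hc
    set v := truncate u c (c + 1) with hv
    have hvc : v c = d := if_pos ⟨le_rfl, by omega⟩
    have hv0 : ∀ k, k ≠ c → v k = 0 := fun k hk => if_neg (by omega)
    have hvs : ∀ k, v k ≠ 0 → c ≤ k ∧ k < c + 1 := fun k hk => by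
      have : k = c := by
        by_contra hne
        exact hk (hv0 k hne)
      omega
    have hw : IsAdmissible ν τ (glue x v p) := by
      refine isAdmissible_glue hx (isAdmissible_truncate hu' c (c + 1)) hτ hxs hvs (by omega) ?_
        (not_colourClash hCD h₁ h₁' (hvc.symm ▸ hd) fun k hk => hv0 k (by omega))
      have e : (c + 1 - c : ℤ) = 1 := by ring
      rw [e, Int.cast_one]
      refine hM.trans ?_
      rw [← Int.cast_natCast, Int.cast_le]
      omega
    have hwleft : ∀ k < p, glue x v p k = x k := fun k hk => if_pos hk
    have hwright : ∀ k, p ≤ k → glue x v p k = v k := fun k hk => if_neg (by omega)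
    have hws : ∀ k, glue x v p k ≠ 0 → r ≤ k ∧ k < c + 1 := fun k hk => by
      rcases lt_or_ge k p with h | h
      · rw [hwleft k h] at hk
        have := hxs k hk
        omega
      · rw [hwright k h] at hk
        have := hvs k hk
        omega
    have hwc : glue x v p c ∈ D := by
      rw [hwright c (by omega), hvc]
      exact hd
    obtain ⟨N, hN⟩ := exists_isAdmissible_of_not_colourClash hτ hw hy hws hys
      (not_colourClash hCD.symm hwc
        (fun k hk => by rw [hwright k (by omega)]; exact hv0 k (by omega)) h₂ h₂')
    refine ⟨N, fun n hn => ?_⟩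
    obtain ⟨z, hz, hzx, hzy⟩ := hN n hn
    exact ⟨z, hz, fun k hk => (hzx k (by omega)).trans (hwleft k hk), hzy⟩
  · exact exists_isAdmissible_of_not_colourClash hτ hx hy hxs hys hcol

theorem exists_window_subset {U : Set (twoColourSubshift ν τ).carrier} (hU : IsOpen U)
    {x : (twoColourSubshift ν τ).carrier} (hx : x ∈ U) :
    ∃ m : ℕ, ∀ z : (twoColourSubshift ν τ).carrier,
      (∀ i : ℤ, -(m : ℤ) ≤ i → i ≤ m → z.1 i = x.1 i) → z ∈ U := by
  obtain ⟨V, hV, hVU⟩ := UniformSpace.mem_nhds_iff.mp (hU.mem_nhds hx)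
  obtain ⟨m, hm⟩ := exists_window_of_mem_uniformity hV
  exact ⟨m, fun z hz => hVU (hm x z fun i hi hi' => (hz i hi hi').symm)⟩

theorem topologicallyMixing_twoColourShift (hν : 2 ≤ ν) (hτ : 0 < τ) :
    TopologicallyMixing (twoColourShift ν τ) := by
  rintro U V hU ⟨x, hx⟩ hV ⟨y, hy⟩
  obtain ⟨m, hm⟩ := exists_window_subset hU hx
  obtain ⟨l, hl⟩ := exists_window_subset hV hy
  have hsupp : ∀ (w : ℤ → Fin (2 * ν + 1)) (p q i : ℤ), truncate w p q i ≠ 0 → p ≤ i ∧ i < q :=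
    fun w p q i hi => by
      by_contra hcon
      exact hi (if_neg hcon)
  obtain ⟨N, hN⟩ := exists_isAdmissible_of_bounded hν hτ
    (isAdmissible_truncate x.2 (-m) (m + 1)) (isAdmissible_truncate y.2 (-l) (l + 1))
    (hsupp _ _ _) (hsupp _ _ _)
  refine ⟨N, fun n hn => ?_⟩
  obtain ⟨z, hz, hzx, hzy⟩ := hN n hn
  refine ⟨⟨z, hz⟩, hm _ fun i hi hi' => ?_, hl _ fun i hi hi' => ?_⟩
  · exact (hzx i (by omega)).trans (if_pos ⟨hi, by omega⟩)
  · rw [twoColourShift_iterate_apply]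
    exact (hzy i hi).trans (if_pos ⟨hi, by omega⟩)

end Mixing

theorem mainTheorem1 (ν : ℕ) (hν : 2 ≤ ν) (τ : ℝ) (hτ : Real.log 3 / Real.log ν ≤ τ) :
    TopologicallyMixing (twoColourShift ν τ) ∧
    IsMeasureOfMaximalEntropy (twoColourShift ν τ) (bernoulliOn ν τ (green ν)) ∧
    IsMeasureOfMaximalEntropy (twoColourShift ν τ) (bernoulliOn ν τ (yellow ν)) ∧
    Ergodic (twoColourShift ν τ) (bernoulliOn ν τ (green ν)) ∧
    Ergodic (twoColourShift ν τ) (bernoulliOn ν τ (yellow ν)) ∧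
    bernoulliOn ν τ (green ν) ⟂ₘ bernoulliOn ν τ (yellow ν) := by
  have hg : green ν = green ν ∨ green ν = yellow ν := Or.inl rfl
  have hy : yellow ν = green ν ∨ yellow ν = yellow ν := Or.inr rfl
  exact ⟨topologicallyMixing_twoColourShift hν (tau_pos hν hτ),
    isMeasureOfMaximalEntropy_bernoulliOn hν hτ hg, isMeasureOfMaximalEntropy_bernoulliOn hν hτ hy,
    ergodic_twoColourShift_bernoulliOn τ hν hg, ergodic_twoColourShift_bernoulliOn τ hν hy,
    bernoulliOn_mutuallySingular τ hν⟩
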